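/- Let $d\ge 3$ and $d\le m<2d-2$ be integers, $\mathcal A=\{0,\dots,m\}$, and let $(p_0,\dots,p_m)$ be a probability vector with all $p_i>0$ that is regular: $p_0\le p_i$ and $p_m\le p_i$ for $1\le i\le m-1$. Put $\delta=-1/\log d$, $\xi=m/(d-1)$, and $\pi(\sigma)=\sum_{i\ge 1}\sigma_i d^{-i}$ for finite words and infinite sequences $\sigma$ over $\mathcal A$. Let $\mu$ be the self-similar measure of the weighted system $\{(x/d+i/d,\,p_i):0\le i\le m\}$, that is, the distribution of $\sum_{i\ge1}X_i d^{-i}$ where the $X_i$ are independent and take the value $j\in\mathcal A$ with probability $p_j$. Its Hausdorff multifractal spectrum is $$f_H(\alpha)=\dim_H\Big\{x\in\operatorname{supp}\mu:\ \lim_{r\to0^+}\frac{\log\mu(B(x,r))}{\log r}=\alpha\Big\},\qquad \dim_H\varnothing=-\infty .$$ For $\sigma\in\mathcal A^k$ let $\eta(\sigma)=\sum\{p_{\sigma'_1}\cdots p_{\sigma'_k}:\sigma'\in\mathcal A^k,\ \pi(\sigma')=\pi(\sigma)\}$. For every $k$ let $\Xi_k\subset\mathcal A^k$ be such that $\pi|_{\Xi_k}$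 is injective and $\pi(\Xi_k)=\pi(\mathcal A^k)$. Let $a=1+\lfloor (m-d)/(d-1)\rfloor$; with $p_j=0$ for $j\notin\mathcal A$, let $M_i$ $(i\in\mathcal A)$ be the matrix $M_i(k,l)=p_{-ld+k+i}$, $-a\le k,l\le a$, and put $M(\sigma)=M_{\sigma_k}\cdots M_{\sigma_1}$. With $\rho$ denoting the spectral radius, let $$\underline\alpha=\delta\log\limsup_{k\to\infty}\Big(\sup_{i_1,\dots,i_k\in\mathcal A}\rho(M_{i_1}\cdots M_{i_k})\Big)^{1/k},\qquad \alpha^*=\delta\log\inf_{\sigma}\rho(M(\sigma))^{1/|\sigma|},$$ the infimum being over all nonempty finite words $\sigma$ with $\sigma_1\notin\{0,m\}$. Let $w\in\mathcal A^n$ be a barrier word (a barrier digit if $n=1$): every $\omega\in\mathcal A^{\mathbb N}$ that begins with $w$ satisfies $\pi(\omega)-1<0<\xi<\pi(\omega)+1$. For $k\ge n$ put $\hat S_k(q)=\sum_{\sigma\in\Xi_{k-n}}\eta(w,\sigma)^q$, where $(w,\sigma)$ is the concatenation. Then the limit $\hat\tau(q)=\lim_{k\to\infty}\delta k^{-1}\log\hat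 S_k(q)$ exists for every $q\in\mathbb R$, and $$f_H(\alpha)=\hat\tau^*(\alpha):=\inf_{q\in\mathbb R}\big(q\alpha-\hat\tau(q)\big)\qquad\text{for every }\alpha\in(\underline\alpha,\alpha^*).$$ -/

import Mathlib

open MeasureTheory Filter Topology

noncomputable section

namespace OverlapIFS

/-- A probability vector `(p_0, …, p_m)` with (strictly) positive weights. -/
structure ProbVector (m : ℕ) where
  weight : Fin (m + 1) → ℝ
  pos : ∀ i, 0 < weight i
  sum_eq_one : ∑ i, weight i = 1

/-- The vector is regular: `p_0, p_m ≤ p_i` for `i = 1, …, m - 1`. -/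
def ProbVector.Regular {m : ℕ} (p : ProbVector m) : Prop :=
  ∀ i : Fin (m + 1), i ≠ 0 → i ≠ Fin.last m →
    p.weight 0 ≤ p.weight i ∧ p.weight (Fin.last m) ≤ p.weight i

/-- The convention `p_j = 0` for integers `j ∉ {0, …, m}`. -/
def ProbVector.ext {m : ℕ} (p : ProbVector m) (j : ℤ) : ℝ :=
  if h : 0 ≤ j ∧ j ≤ m then p.weight ⟨j.toNat, by omega⟩ else 0

/-- The law of one random digit: `i` has probability `p_i`. -/
def digitLaw {m : ℕ} (p : ProbVector m) : Measure (Fin (m + 1)) :=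
  ∑ i, ENNReal.ofReal (p.weight i) • Measure.dirac i

/-- The Bernoulli (product) measure on infinite sequences of digits. -/
def bernoulliMeasure {m : ℕ} (p : ProbVector m) : Measure (ℕ → Fin (m + 1)) :=
  Measure.infinitePi fun _ => digitLaw p

/-- The projection `π(ω) = ∑_{i ≥ 1} ω_i d^{-i}` of infinite sequences
(digits are indexed from `0` here). -/
def projInf (d : ℕ) {m : ℕ} (ω : ℕ → Fin (m + 1)) : ℝ :=
  ∑' i, ((ω i : ℕ) : ℝ) / (d : ℝ) ^ (i + 1)

/-- The self-similar measure of the weighted system `{(x / d + i / d, p_i) : 0 ≤ i ≤ m}`: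
the distribution of the random sum `∑_{i ≥ 1} X_i d^{-i}`. -/
def selfSimilarMeasure (d : ℕ) {m : ℕ} (p : ProbVector m) : Measure ℝ :=
  (bernoulliMeasure p).map (projInf d)

/-- The right end point `ξ = m / (d - 1)` of the support. -/
def xi (d m : ℕ) : ℝ := (m : ℝ) / ((d : ℝ) - 1)

/-- `δ = -1 / log d`. -/
def delta (d : ℕ) : ℝ := -1 / Real.log d

/-- The projection `π(σ)` of a finite word. -/
def proj (d : ℕ) {m k : ℕ} (σ : Fin k → Fin (m + 1)) : ℝ :=
  ∑ i : Fin k, ((σ i : ℕ) : ℝ) / (d : ℝ) ^ ((i : ℕ) + 1)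

/-- `p(σ) = ∏_j p_{σ(j)}`. -/
def wordWeight {m k : ℕ} (p : ProbVector m) (σ : Fin k → Fin (m + 1)) : ℝ :=
  ∏ i, p.weight (σ i)

open Classical in
/-- `η(σ)`: total weight of the words with the same length and the same projection as `σ`. -/
def eta (d : ℕ) {m k : ℕ} (p : ProbVector m) (σ : Fin k → Fin (m + 1)) : ℝ :=
  ∑ σ' : Fin k → Fin (m + 1) with proj d σ' = proj d σ, wordWeight p σ'

/-- `Ξ ⊆ A^k` contains exactly one word from each class of words of length `k` with the same
projection: `π` is injective on `Ξ` and `π(Ξ) = π(A^k)`. -/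
def IsTransversal (d : ℕ) {m k : ℕ} (Ξ : Finset (Fin k → Fin (m + 1))) : Prop :=
  Set.InjOn (proj d) (Ξ : Set (Fin k → Fin (m + 1))) ∧
    proj d '' (Ξ : Set (Fin k → Fin (m + 1))) =
      Set.range (proj d : (Fin k → Fin (m + 1)) → ℝ)

/-- `w` is a barrier word: `π(ω) - 1 < 0 < ξ < π(ω) + 1` for each infinite sequence `ω` that
begins with `w`. A barrier digit is a barrier word of length one. -/
def IsBarrier (d : ℕ) {m n : ℕ} (w : Fin n → Fin (m + 1)) : Prop :=
  ∀ ω : ℕ → Fin (m + 1), (∀ i : Fin n, ω i = w i) →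
    projInf d ω - 1 < 0 ∧ 0 < xi d m ∧ xi d m < projInf d ω + 1

/-- The sum `∑_{σ ∈ Ξ} η(w, σ)^q`; when `Ξ` is a transversal of the words of length `k` and
`w` has length `n`, this is `Ŝ_{n + k}(q)`. -/
def hatS (d : ℕ) {m n k : ℕ} (p : ProbVector m) (w : Fin n → Fin (m + 1))
    (Ξ : Finset (Fin k → Fin (m + 1))) (q : ℝ) : ℝ :=
  ∑ σ ∈ Ξ, eta d p (Fin.append w σ) ^ q

/-- `a = 1 + ⌊(m - d) / (d - 1)⌋` (used for `m ≥ d`). -/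
def halfWidth (d m : ℕ) : ℕ := 1 + (m - d) / (d - 1)

/-- The index set `{-a, …, a}`. -/
abbrev Idx (d m : ℕ) : Type :=
  {j : ℤ // j ∈ Finset.Icc (-(halfWidth d m : ℤ)) (halfWidth d m : ℤ)}

/-- The transfer matrix `M_i(k, l) = p_{-ld + k + i}`. -/
def transfer (d : ℕ) {m : ℕ} (p : ProbVector m) (i : Fin (m + 1)) :
    Matrix (Idx d m) (Idx d m) ℝ :=
  fun k l => p.ext (-(l : ℤ) * d + k + ((i : ℕ) : ℤ))

/-- `M(σ) = M_{σ(k)} ⋯ M_{σ(1)}`. -/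
def wordTransfer (d : ℕ) {m k : ℕ} (p : ProbVector m) (σ : Fin k → Fin (m + 1)) :
    Matrix (Idx d m) (Idx d m) ℝ :=
  (List.ofFn fun i => transfer d p (σ i)).reverse.prod

/-- The spectral radius of a real square matrix: the largest modulus of its complex
eigenvalues. -/
def rho {ι : Type} [Fintype ι] [DecidableEq ι] (A : Matrix ι ι ℝ) : ℝ :=
  (spectralRadius ℂ (A.map (algebraMap ℝ ℂ))).toReal

/-- The generalized spectral radius `limsup_k (sup ρ(A_1 ⋯ A_k))^{1/k}` of a finite family. -/
def genSpectralRadius {ι J : Type} [Fintype ι] [DecidableEq ι] (A : J → Matrix ι ι ℝ) : ℝ :=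
  limsup (fun k : ℕ =>
    (⨆ s : Fin k → J, rho (List.ofFn fun i => A (s i)).prod) ^ (1 / (k : ℝ))) atTop

/-- `inf {ρ(M(σ))^{1/|σ|}}` over the nonempty finite words `σ` whose first digit is neither
`0` nor `m`. -/
def lowerSpectralRadius (d : ℕ) {m : ℕ} (p : ProbVector m) : ℝ :=
  sInf {r : ℝ | ∃ (k : ℕ) (σ : Fin (k + 1) → Fin (m + 1)), σ 0 ≠ 0 ∧ σ 0 ≠ Fin.last m ∧
    r = rho (wordTransfer d p σ) ^ (1 / ((k : ℝ) + 1))}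

/-- The lower end point `δ log ρ̃(M_0, …, M_m)`. -/
def alphaLow (d : ℕ) {m : ℕ} (p : ProbVector m) : ℝ :=
  delta d * Real.log (genSpectralRadius (transfer d p))

/-- The upper end point `α*`. -/
def alphaStar (d : ℕ) {m : ℕ} (p : ProbVector m) : ℝ :=
  delta d * Real.log (lowerSpectralRadius d p)

/-- The local dimension of `μ` at `x` exists and equals `α`. -/
def HasLocalDim (μ : Measure ℝ) (x α : ℝ) : Prop :=
  Tendsto (fun r : ℝ => Real.log (μ.real (Metric.closedBall x r)) / Real.log r)
    (𝓝[>] 0) (𝓝 α)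

/-- The points of the support at which the local dimension exists and equals `α`. -/
def levelSet (μ : Measure ℝ) (α : ℝ) : Set ℝ := {x | x ∈ μ.support ∧ HasLocalDim μ x α}

open Classical in
/-- The Hausdorff multifractal spectrum `f_H(α)`, with the convention `dim_H ∅ = -∞`. -/
def hausdorffSpectrum (μ : Measure ℝ) (α : ℝ) : EReal :=
  if levelSet μ α = ∅ then ⊥ else ((dimH (levelSet μ α) : ENNReal) : EReal)

/-- The Legendre transform `g*(α) = inf_q (q α - g(q))`, as an extended real. -/
def legendre (g : ℝ → ℝ) (α : ℝ) : EReal := ⨅ q : ℝ, ((q * α - g q : ℝ) : EReal)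

end OverlapIFS

end

/-! Words matter only through the integer `val d σ`, because `proj d σ = val d σ / d ^ k`. Write
W_k(N) for `valWeight d p k N`, the probability that k random digits have value N; this is `eta`. A
barrier value M at level L is one whose cylinder lies in the interval (ξ - 1, 1), away from every
nonzero integer translate of [0, ξ]. A word whose value ends in the block M then has only one
possible value for its prefix, so W(T d^L + M) = W(T) W(M) exactly (`IsBarrierVal.valWeight_add`).
The barrier property passes from w to all w-prefixed words, so the sums Ŝ are supermultiplicative
for every real q. Fekete's lemma gives τ̂(q) as the infimum of its approximations τ_k(q)
(`exists_tau`).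

Upper bound (`dimH_levelSet_le`): for each q, count the d-adic intervals that a level set meets. For
q ≥ 0 the full partition sum is bounded by a multiple of the prefixed one. For q ≤ 0 small weights
are dangerous. Apart from the two end points of the support, however, each point has a coding with a
prefix of interior value u, 0 < u < `maxVal`. Since ξ < 2, only the shifts -1, 0, 1 of a suffix
carry mass, and an interior prefix sees all three, so its weights dominate those with prefix w
(`exists_mul_valWeight_le`).

Lower bound (`le_dimH_levelSet`): the w-prefixed values of length L = n + k act as digits of a
separated system in base d^L, with multiplicative weights. Put a_M = W_L(M) d^{αL} and give digit M
the probability a_M^q / ∑ a^q, where q minimises ∑ a^q. Criticality says that log a_M has mean zero,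
so the strong law gives local dimension α almost surely. The mass distribution principle then bounds
the dimension below by min_q (qα - τ_k(q)).

The minimum exists because weights above and below d^{-αL} both occur; this is where α lies strictly
between the two spectral-radius end points (`exists_straddles`). Along lengths with n + k doubling,
the functions qα - τ_k(q) increase to qα - τ̂(q), and compactness of sublevel sets passes the minima
to the limit. -/

noncomputable section

namespace OverlapIFS

/-! ### Values of words, their weights, and factorisation at barrier values. -/

section

/-- The integer `∑ σ_i d^{k-1-i}`, so that `proj d σ = val d σ / d ^ k`. -/
def val (d : ℕ) {m k : ℕ} (σ : Fin k → Fin (m + 1)) : ℕ :=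
  ∑ i : Fin k, (σ i : ℕ) * d ^ (k - 1 - (i : ℕ))

/-- The largest value of a word of length `k`. -/
def maxVal (d m k : ℕ) : ℕ := m * ∑ i ∈ Finset.range k, d ^ i

/-- The total weight of the words of length `k` and value `N`. -/
def valWeight (d : ℕ) {m : ℕ} (p : ProbVector m) (k : ℕ) (N : ℤ) : ℝ :=
  ∑ σ : Fin k → Fin (m + 1), if (val d σ : ℤ) = N then wordWeight p σ else 0

/-- The `w`-prefixed partition function, indexed by values. -/
def prefixSum (d : ℕ) {m : ℕ} (p : ProbVector m) (n : ℕ) (v : ℤ) (k : ℕ) (q : ℝ) : ℝ :=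
  ∑ M ∈ Finset.range (maxVal d m k + 1), valWeight d p (n + k) (v * (d : ℤ) ^ k + M) ^ q

/-- A value at level `L` whose cylinder is disjoint from the neighbouring copies of the support. -/
def IsBarrierVal (d m L : ℕ) (M : ℤ) : Prop :=
  ((d : ℤ) - 1) * M + m < ((d : ℤ) - 1) * (d : ℤ) ^ L ∧
    (m : ℤ) * (d : ℤ) ^ L < ((d : ℤ) - 1) * (M + (d : ℤ) ^ L)

variable {d m : ℕ}

lemma val_append {k l : ℕ} (σ : Fin k → Fin (m + 1)) (τ : Fin l → Fin (m + 1)) :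
    val d (Fin.append σ τ) = val d σ * d ^ l + val d τ := by
  unfold val
  rw [Fin.sum_univ_add, Finset.sum_mul]
  congr 1
  · refine Finset.sum_congr rfl fun i _ => ?_
    rw [Fin.append_left, mul_assoc, ← pow_add]
    congr 2
    simp only [Fin.val_castAdd]
    omega
  · refine Finset.sum_congr rfl fun i _ => ?_
    rw [Fin.append_right]
    congr 2
    simp only [Fin.val_natAdd]
    omega

lemma proj_eq (hd : 0 < d) {k : ℕ} (σ : Fin k → Fin (m + 1)) :
    proj d σ = (val d σ : ℝ) / (d : ℝ) ^ k := by
  unfold proj val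
  push_cast
  rw [Finset.sum_div]
  refine Finset.sum_congr rfl fun i _ => ?_
  have hd' : (d : ℝ) ≠ 0 := by positivity
  rw [div_eq_div_iff (by positivity) (by positivity), mul_assoc, ← pow_add]
  congr 2
  omega

lemma proj_eq_iff (hd : 0 < d) {k : ℕ} (σ τ : Fin k → Fin (m + 1)) :
    proj d σ = proj d τ ↔ val d σ = val d τ := by
  rw [proj_eq hd, proj_eq hd, div_left_inj' (by positivity), Nat.cast_inj]

lemma eta_eq (hd : 0 < d) (p : ProbVector m) {k : ℕ} (σ : Fin k → Fin (m + 1)) :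
    eta d p σ = valWeight d p k (val d σ) := by
  unfold eta valWeight
  rw [Finset.sum_filter]
  refine Finset.sum_congr rfl fun τ _ => ?_
  simp [proj_eq_iff hd]

lemma maxVal_zero : maxVal d m 0 = 0 := by simp [maxVal]

lemma maxVal_one : maxVal d m 1 = m := by simp [maxVal]

lemma maxVal_add (k l : ℕ) : maxVal d m (k + l) = maxVal d m k * d ^ l + maxVal d m l := by
  unfold maxVal
  rw [add_comm k l, Finset.sum_range_add, mul_add, add_comm, mul_assoc, Finset.sum_mul]
  congr 2
  exact Finset.sum_congr rfl fun i _ => by ring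

lemma maxVal_mul (k : ℕ) :
    ((d : ℤ) - 1) * maxVal d m k = m * ((d : ℤ) ^ k - 1) := by
  unfold maxVal
  push_cast
  rw [← geom_sum_mul]
  ring

lemma val_le_maxVal {k : ℕ} (σ : Fin k → Fin (m + 1)) : val d σ ≤ maxVal d m k := by
  unfold val maxVal
  rw [← Finset.sum_range_reflect, Finset.sum_range, Finset.mul_sum]
  exact Finset.sum_le_sum fun i _ => Nat.mul_le_mul_right _ (Nat.lt_succ_iff.1 (σ i).2)

/-- Since m ≥ d, `maxVal d m k ≥ d ^ k - 1`. The ranges reached after fixing the leading digit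
therefore leave no gap, and a greedy leading digit works. -/
lemma exists_val_eq (hd : 0 < d) (hdm : d ≤ m) (k N : ℕ) (hN : N ≤ maxVal d m k) :
    ∃ σ : Fin k → Fin (m + 1), val d σ = N := by
  induction k generalizing N with
  | zero =>
    rw [maxVal_zero] at hN
    exact ⟨fun _ => 0, by simp [val]; omega⟩
  | succ k ih =>
    have hR : d ^ k - 1 ≤ maxVal d m k := by
      have h1 := maxVal_mul (d := d) (m := m) k
      have h2 : (1 : ℤ) ≤ (d : ℤ) ^ k := by exact_mod_cast Nat.one_le_pow _ _ hd
      have h3 : (d : ℤ) ^ k - 1 ≤ maxVal d m k := by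
        by_contra! h
        have h4 : ((d : ℤ) - 1) * maxVal d m k ≤ ((d : ℤ) - 1) * ((d : ℤ) ^ k - 1) :=
          mul_le_mul_of_nonneg_left h.le (by omega)
        rcases eq_or_lt_of_le h2 with h2 | h2
        · rw [← h2] at h
          omega
        · nlinarith
      zify [Nat.one_le_pow k d hd]
      exact h3
    have key : ∃ i : ℕ, i ≤ m ∧ i * d ^ k ≤ N ∧ N - i * d ^ k ≤ maxVal d m k := by
      rw [add_comm, maxVal_add, maxVal_one] at hN
      rcases le_or_gt (N / d ^ k) m with h | h
      · refine ⟨N / d ^ k, h, Nat.div_mul_le_self _ _, ?_⟩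
        have := Nat.div_add_mod' N (d ^ k)
        have := Nat.mod_lt N (pow_pos hd k)
        omega
      · have := (Nat.le_div_iff_mul_le (pow_pos hd k)).1 h.le
        exact ⟨m, le_rfl, this, by omega⟩
    obtain ⟨i, hi, h1, h2⟩ := key
    obtain ⟨σ, hσ⟩ := ih _ h2
    have hv := val_append (d := d) (fun _ : Fin 1 => (⟨i, by omega⟩ : Fin (m + 1))) σ
    have h3 : val d (fun _ : Fin 1 => (⟨i, by omega⟩ : Fin (m + 1))) = i := by simp [val]
    rw [h3, hσ] at hv
    have : ∃ σ' : Fin (1 + k) → Fin (m + 1), val d σ' = N := ⟨_, hv.trans (by omega)⟩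
    rwa [add_comm 1 k] at this

variable (p : ProbVector m)

lemma wordWeight_pos {k : ℕ} (σ : Fin k → Fin (m + 1)) : 0 < wordWeight p σ :=
  Finset.prod_pos fun _ _ => p.pos _

lemma wordWeight_append {k l : ℕ} (σ : Fin k → Fin (m + 1)) (τ : Fin l → Fin (m + 1)) :
    wordWeight p (Fin.append σ τ) = wordWeight p σ * wordWeight p τ := by
  simp [wordWeight, Fin.prod_univ_add]

lemma sum_wordWeight (k : ℕ) : ∑ σ : Fin k → Fin (m + 1), wordWeight p σ = 1 := by
  unfold wordWeight
  rw [← Fintype.prod_sum]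
  simp [p.sum_eq_one]

lemma valWeight_nonneg (k : ℕ) (N : ℤ) : 0 ≤ valWeight d p k N :=
  Finset.sum_nonneg fun σ _ => by split_ifs <;> [exact (wordWeight_pos p σ).le; exact le_rfl]

lemma valWeight_le_one (k : ℕ) (N : ℤ) : valWeight d p k N ≤ 1 := by
  rw [← sum_wordWeight p k]
  exact Finset.sum_le_sum fun σ _ => by
    split_ifs <;> [exact le_rfl; exact (wordWeight_pos p σ).le]

lemma wordWeight_le_valWeight {k : ℕ} (σ : Fin k → Fin (m + 1)) :
    wordWeight p σ ≤ valWeight d p k (val d σ) := by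
  have := Finset.single_le_sum (f := fun τ : Fin k → Fin (m + 1) =>
    if (val d τ : ℤ) = val d σ then wordWeight p τ else 0)
    (fun τ _ => by split_ifs <;> [exact (wordWeight_pos p τ).le; exact le_rfl])
    (Finset.mem_univ σ)
  simpa [valWeight] using this

lemma valWeight_pos (hd : 0 < d) (hdm : d ≤ m) {k : ℕ} {N : ℤ} (h0 : 0 ≤ N)
    (h1 : N ≤ maxVal d m k) : 0 < valWeight d p k N := by
  obtain ⟨σ, hσ⟩ := exists_val_eq hd hdm k N.toNat (by omega)
  have := wordWeight_le_valWeight (d := d) p σ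
  rw [hσ, Int.toNat_of_nonneg h0] at this
  exact (wordWeight_pos p σ).trans_le this

lemma valWeight_eq_zero {k : ℕ} {N : ℤ} (h : N < 0 ∨ (maxVal d m k : ℤ) < N) :
    valWeight d p k N = 0 := by
  refine Finset.sum_eq_zero fun σ _ => if_neg ?_
  have := val_le_maxVal (d := d) σ
  omega

lemma valWeight_mem_range {k : ℕ} {N : ℤ} (h : 0 < valWeight d p k N) :
    0 ≤ N ∧ N ≤ maxVal d m k := by
  by_contra h'
  exact h.ne' (valWeight_eq_zero p (by omega))

lemma valWeight_add (k l : ℕ) (N : ℤ) :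
    valWeight d p (k + l) N = ∑ σ : Fin k → Fin (m + 1),
      wordWeight p σ * valWeight d p l (N - val d σ * (d : ℤ) ^ l) := by
  unfold valWeight
  rw [← (Fin.appendEquiv k l).sum_comp, Fintype.sum_prod_type]
  refine Finset.sum_congr rfl fun σ _ => ?_
  rw [Finset.mul_sum]
  refine Finset.sum_congr rfl fun τ _ => ?_
  simp only [Fin.appendEquiv, Equiv.coe_fn_mk, val_append, wordWeight_append, mul_ite, mul_zero]
  push_cast
  congr 1
  exact propext ⟨fun h => by omega, fun h => by omega⟩

lemma sum_wordWeight_mul (k : ℕ) (g : ℤ → ℝ) (F : Finset ℤ) (hF : ∀ t ∉ F, g t = 0) :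
    ∑ σ : Fin k → Fin (m + 1), wordWeight p σ * g (val d σ) =
      ∑ t ∈ F, valWeight d p k t * g t := by
  simp_rw [valWeight, Finset.sum_mul, ite_mul, zero_mul]
  rw [Finset.sum_comm]
  refine Finset.sum_congr rfl fun σ _ => ?_
  rw [Finset.sum_ite_eq]
  split_ifs with h
  · rfl
  · rw [hF _ h, mul_zero]

/-- Only the prefixes of value T are kept in the convolution `valWeight_add`. Other prefixes may
also contribute; for a barrier suffix they do not. -/
lemma valWeight_mul_le (k l : ℕ) (T M : ℤ) :
    valWeight d p k T * valWeight d p l M ≤ valWeight d p (k + l) (T * (d : ℤ) ^ l + M) := by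
  rw [valWeight_add, valWeight, Finset.sum_mul]
  refine Finset.sum_le_sum fun σ _ => ?_
  split_ifs with h
  · rw [h, add_sub_cancel_left]
  · rw [zero_mul]
    exact mul_nonneg (wordWeight_pos p σ).le (valWeight_nonneg p _ _)

/-- The two barrier inequalities give M < d^L and `maxVal` < M + d^L, so any nonzero shift by a
multiple of d^L leaves the range of values. -/
lemma IsBarrierVal.valWeight_eq_zero {L : ℕ} {M : ℤ} (hd : 1 < d) (hM : IsBarrierVal d m L M)
    {t : ℤ} (ht : t ≠ 0) : valWeight d p L (M + t * (d : ℤ) ^ L) = 0 := by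
  refine OverlapIFS.valWeight_eq_zero p ?_
  have hp : (0 : ℤ) < (d : ℤ) ^ L := by positivity
  have hd' : (0 : ℤ) < (d : ℤ) - 1 := by omega
  obtain ⟨h1, h2⟩ := hM
  rcases lt_or_gt_of_ne ht with ht | ht
  · left
    have h3 : M < (d : ℤ) ^ L := by
      by_contra! h
      have := mul_le_mul_of_nonneg_left h hd'.le
      omega
    nlinarith
  · right
    have h3 := maxVal_mul (d := d) (m := m) L
    have h4 : (maxVal d m L : ℤ) < M + (d : ℤ) ^ L := by
      by_contra! h
      have := mul_le_mul_of_nonneg_left h hd'.le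
      nlinarith
    nlinarith

/-- In the convolution over prefixes, a prefix value other than T would require a shifted suffix,
which has weight zero. Equality here is what permits negative powers later. -/
lemma IsBarrierVal.valWeight_add {k L : ℕ} {M : ℤ} (hd : 1 < d) (hM : IsBarrierVal d m L M)
    (T : ℤ) : valWeight d p (k + L) (T * (d : ℤ) ^ L + M) =
      valWeight d p k T * valWeight d p L M := by
  rw [OverlapIFS.valWeight_add, valWeight, Finset.sum_mul]
  refine Finset.sum_congr rfl fun σ _ => ?_
  split_ifs with h
  · rw [h, add_sub_cancel_left]
  · rw [zero_mul, show T * (d : ℤ) ^ L + M - val d σ * (d : ℤ) ^ L =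
      M + (T - val d σ) * (d : ℤ) ^ L by ring,
      hM.valWeight_eq_zero p hd (sub_ne_zero.2 (Ne.symm h)), mul_zero]

/-- Values with a barrier prefix are barrier values. -/
lemma IsBarrierVal.append {n k : ℕ} {v M : ℤ} (hd : 1 < d) (hv : IsBarrierVal d m n v)
    (h0 : 0 ≤ M) (hM : M ≤ maxVal d m k) : IsBarrierVal d m (n + k) (v * (d : ℤ) ^ k + M) := by
  obtain ⟨h1, h2⟩ := hv
  have hp : (0 : ℤ) < (d : ℤ) ^ k := by positivity
  have hd' : (0 : ℤ) < (d : ℤ) - 1 := by omega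
  have h3 := maxVal_mul (d := d) (m := m) k
  have h4 := mul_le_mul_of_nonneg_left hM hd'.le
  have h5 := mul_lt_mul_of_pos_right h1 hp
  have h6 := mul_lt_mul_of_pos_right h2 hp
  have h7 := mul_nonneg hd'.le h0
  constructor
  · rw [pow_add]; nlinarith
  · rw [pow_add]; nlinarith

lemma IsBarrierVal.nonneg {L : ℕ} {M : ℤ} (hd : 1 < d) (hdm : d ≤ m)
    (hM : IsBarrierVal d m L M) : 0 < M := by
  have hp : (0 : ℤ) < (d : ℤ) ^ L := by positivity
  have hd' : (0 : ℤ) < (d : ℤ) - 1 := by omega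
  have h : ((d : ℤ) - 1) * (d : ℤ) ^ L ≤ m * (d : ℤ) ^ L :=
    mul_le_mul_of_nonneg_right (by omega) hp.le
  have := hM.2
  by_contra! h'
  nlinarith

/-- Because m ≥ d - 1, the barrier inequality gains one more unit: M is below the top digit d^L - 1.
This unit later becomes the separation `gap`. -/
lemma IsBarrierVal.lt_pow {L : ℕ} {M : ℤ} (hd : 1 < d) (hdm : d ≤ m)
    (hM : IsBarrierVal d m L M) : M + 2 ≤ (d : ℤ) ^ L := by
  have hd' : (0 : ℤ) < (d : ℤ) - 1 := by omega
  have := hM.1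
  by_contra! h'
  nlinarith

lemma IsBarrierVal.le_maxVal {L : ℕ} {M : ℤ} (hd : 1 < d) (hdm : d ≤ m)
    (hM : IsBarrierVal d m L M) : M ≤ maxVal d m L := by
  have hd' : (0 : ℤ) < (d : ℤ) - 1 := by omega
  have h1 := hM.1
  have h3 := maxVal_mul (d := d) (m := m) L
  have hp : (1 : ℤ) ≤ (d : ℤ) ^ L := by exact_mod_cast Nat.one_le_pow _ _ (by omega)
  by_contra! h'
  nlinarith

lemma prefixSum_pos {n : ℕ} {v : ℤ} (hd : 1 < d) (hdm : d ≤ m) (hv : IsBarrierVal d m n v)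
    (k : ℕ) (q : ℝ) : 0 < prefixSum d p n v k q := by
  refine Finset.sum_pos (fun M hM => Real.rpow_pos_of_pos ?_ _) ⟨0, by simp⟩
  have hb := hv.append hd (M := (M : ℤ)) (k := k) (by omega)
    (by exact_mod_cast Nat.lt_succ_iff.1 (Finset.mem_range.1 hM))
  exact valWeight_pos p (by omega) hdm (hb.nonneg hd hdm).le (hb.le_maxVal hd hdm)

/-- Concatenation of two `v`-prefixed values: the suffix of the result. -/
lemma exists_concat {n : ℕ} {v : ℤ} (hd : 1 < d) (hdm : d ≤ m) (hv : IsBarrierVal d m n v)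
    {k l : ℕ} {M M' : ℕ} (hM : M ≤ maxVal d m k) (hM' : M' ≤ maxVal d m l) :
    ∃ K : ℕ, K ≤ maxVal d m (k + n + l) ∧
      (K : ℤ) = M * (d : ℤ) ^ (n + l) + (v * (d : ℤ) ^ l + M') ∧
      valWeight d p (n + (k + n + l)) (v * (d : ℤ) ^ (k + n + l) + K) =
        valWeight d p (n + k) (v * (d : ℤ) ^ k + M) *
          valWeight d p (n + l) (v * (d : ℤ) ^ l + M') := by
  have hb := hv.append hd (M := (M' : ℤ)) (k := l) (by omega) (by exact_mod_cast hM')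
  have h0 := hb.nonneg hd hdm
  have h1 := hb.le_maxVal hd hdm
  have h2 : (M : ℤ) * (d : ℤ) ^ (n + l) ≤ maxVal d m k * (d : ℤ) ^ (n + l) :=
    mul_le_mul_of_nonneg_right (by exact_mod_cast hM) (by positivity)
  have h3 : (0 : ℤ) ≤ (M : ℤ) * (d : ℤ) ^ (n + l) := by positivity
  refine ⟨(M * (d : ℤ) ^ (n + l) + (v * (d : ℤ) ^ l + M')).toNat, ?_, ?_, ?_⟩
  · zify
    rw [Int.toNat_of_nonneg (by omega), add_assoc k, maxVal_add]
    push_cast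
    omega
  · rw [Int.toNat_of_nonneg (by omega)]
  · rw [Int.toNat_of_nonneg (by omega), ← hb.valWeight_add p hd,
      show n + (k + n + l) = n + k + (n + l) by ring]
    congr 1
    ring

/-- The weights multiply exactly under concatenation, so the bound holds for either sign of q. It
remains that concatenation is injective and that all terms are nonnegative. -/
lemma prefixSum_mul_le {n : ℕ} {v : ℤ} (hd : 1 < d) (hdm : d ≤ m) (hv : IsBarrierVal d m n v)
    (k l : ℕ) (q : ℝ) :
    prefixSum d p n v k q * prefixSum d p n v l q ≤ prefixSum d p n v (k + n + l) q := by
  unfold prefixSum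
  rw [Finset.sum_mul_sum, ← Finset.sum_product']
  have hex : ∀ x ∈ Finset.range (maxVal d m k + 1) ×ˢ Finset.range (maxVal d m l + 1),
      ∃ K : ℕ, K ≤ maxVal d m (k + n + l) ∧
      (K : ℤ) = x.1 * (d : ℤ) ^ (n + l) + (v * (d : ℤ) ^ l + x.2) ∧
      valWeight d p (n + (k + n + l)) (v * (d : ℤ) ^ (k + n + l) + K) =
        valWeight d p (n + k) (v * (d : ℤ) ^ k + x.1) *
          valWeight d p (n + l) (v * (d : ℤ) ^ l + x.2) := by
    intro x hx
    simp only [Finset.mem_product, Finset.mem_range, Nat.lt_succ_iff] at hx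
    exact exists_concat p hd hdm hv hx.1 hx.2
  choose! f hf1 hf2 hf3 using hex
  have hinj : Set.InjOn f
      (Finset.range (maxVal d m k + 1) ×ˢ Finset.range (maxVal d m l + 1) : Finset (ℕ × ℕ)) := by
    intro x hx y hy hxy
    have h1 := hf2 x hx
    have h2 := hf2 y hy
    rw [hxy, h2] at h1
    simp only [Finset.mem_coe, Finset.mem_product, Finset.mem_range, Nat.lt_succ_iff] at hx hy
    have bx := hv.append hd (M := (x.2 : ℤ)) (k := l) (by omega) (by exact_mod_cast hx.2)
    have bY := hv.append hd (M := (y.2 : ℤ)) (k := l) (by omega) (by exact_mod_cast hy.2)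
    have bx0 := bx.nonneg hd hdm
    have by0 := bY.nonneg hd hdm
    have bx1 := bx.lt_pow hd hdm
    have by1 := bY.lt_pow hd hdm
    -- The barrier suffix lies strictly between 0 and d^{n+l}, so the first component is a quotient
    -- by d^{n+l}.
    have e1 : (x.1 : ℤ) = y.1 := by
      rcases lt_trichotomy (x.1 : ℤ) y.1 with h | h | h
      · nlinarith
      · exact h
      · nlinarith
    rw [e1] at h1
    exact Prod.ext (by exact_mod_cast e1) (by omega)
  calc _ = ∑ x ∈ Finset.range (maxVal d m k + 1) ×ˢ Finset.range (maxVal d m l + 1),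
        valWeight d p (n + (k + n + l)) (v * (d : ℤ) ^ (k + n + l) + f x) ^ q :=
      Finset.sum_congr rfl fun x hx => by
        rw [hf3 x hx, Real.mul_rpow (valWeight_nonneg p _ _) (valWeight_nonneg p _ _)]
    _ = ∑ K ∈ Finset.image f
          (Finset.range (maxVal d m k + 1) ×ˢ Finset.range (maxVal d m l + 1)),
        valWeight d p (n + (k + n + l)) (v * (d : ℤ) ^ (k + n + l) + K) ^ q := by
      rw [Finset.sum_image hinj]
    _ ≤ _ := by
      refine Finset.sum_le_sum_of_subset_of_nonneg ?_
        fun _ _ _ => Real.rpow_nonneg (valWeight_nonneg p _ _) _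
      intro K hK
      obtain ⟨x, hx, rfl⟩ := Finset.mem_image.1 hK
      exact Finset.mem_range.2 (Nat.lt_succ_iff.2 (hf1 x hx))

lemma hatS_eq {n k : ℕ} (hd : 0 < d) (hdm : d ≤ m) (w : Fin n → Fin (m + 1))
    (Ξ : Finset (Fin k → Fin (m + 1))) (hΞ : IsTransversal d Ξ) (q : ℝ) :
    hatS d p w Ξ q = prefixSum d p n (val d w) k q := by
  have himg : Finset.image (val d) Ξ = Finset.range (maxVal d m k + 1) := by
    ext N
    simp only [Finset.mem_image, Finset.mem_range, Nat.lt_succ_iff]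
    constructor
    · rintro ⟨σ, -, rfl⟩
      exact val_le_maxVal σ
    · intro hN
      obtain ⟨σ, rfl⟩ := exists_val_eq hd hdm k N hN
      obtain ⟨τ, hτ, h⟩ : proj d σ ∈ proj d '' (Ξ : Set (Fin k → Fin (m + 1))) := by
        rw [hΞ.2]; exact ⟨σ, rfl⟩
      exact ⟨τ, hτ, (proj_eq_iff hd _ _).1 h⟩
  unfold prefixSum hatS
  rw [← himg, Finset.sum_image fun σ hσ τ hτ h => hΞ.1 hσ hτ ((proj_eq_iff hd _ _).2 h)]
  refine Finset.sum_congr rfl fun σ _ => ?_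
  rw [eta_eq hd, val_append]
  push_cast
  rfl

end

/-! ### Existence of τ̂ by subadditivity, and comparison of prefixes. -/

section

/-- Fekete's lemma for U(n + k) = u(k): the shift by n makes total lengths add. As U is given only
from index n on, the classical argument is repeated along the residues modulo n + k. -/
lemma exists_tendsto_of_shifted_subadditive {n : ℕ} (hn : 0 < n) (u : ℕ → ℝ)
    (hu : ∀ k l, u (k + n + l) ≤ u k + u l) (C : ℝ) (hC : ∀ k, C * ((n + k : ℕ) : ℝ) ≤ u k) :
    ∃ t : ℝ, Tendsto (fun k => u k / ((n + k : ℕ) : ℝ)) atTop (𝓝 t) ∧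
      ∀ k, t ≤ u k / ((n + k : ℕ) : ℝ) := by
  have hpos : ∀ k : ℕ, (0 : ℝ) < ((n + k : ℕ) : ℝ) := fun k => by positivity
  have hbdd : BddBelow (Set.range fun k => u k / ((n + k : ℕ) : ℝ)) :=
    ⟨C, by rintro _ ⟨k, rfl⟩; exact (le_div_iff₀ (hpos k)).2 (hC k)⟩
  refine ⟨_, ?_, fun k => csInf_le hbdd ⟨k, rfl⟩⟩
  refine tendsto_order.2 ⟨fun l hl => Eventually.of_forall fun k =>
    hl.trans_le (csInf_le hbdd ⟨k, rfl⟩), fun L hL => ?_⟩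
  obtain ⟨_, ⟨k, rfl⟩, hk⟩ := exists_lt_of_csInf_lt (Set.range_nonempty _) hL
  have hmul : ∀ j r, u (j * (n + k) + r) ≤ j * u k + u r := by
    intro j r
    induction j with
    | zero => simp
    | succ j ih =>
      calc u ((j + 1) * (n + k) + r) = u (k + n + (j * (n + k) + r)) := by congr 1; ring
        _ ≤ u k + (j * u k + u r) := (hu _ _).trans (by gcongr)
        _ = _ := by push_cast; ring
  refine .atTop_of_arithmetic (n := n + k) (by omega) fun r _ => ?_
  set N : ℝ := ((n + k : ℕ) : ℝ) with hN
  have A : Tendsto (fun x : ℝ => (u k + u r / x) / (N + (n + r) / x)) atTop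
      (𝓝 ((u k + 0) / (N + 0))) :=
    (tendsto_const_nhds.add <| tendsto_const_nhds.div_atTop tendsto_id).div
      (tendsto_const_nhds.add <| tendsto_const_nhds.div_atTop tendsto_id) <| by
        rw [add_zero]; exact (hpos k).ne'
  have B : Tendsto (fun x : ℝ => (x * u k + u r) / (x * N + (n + r))) atTop (𝓝 (u k / N)) := by
    rw [add_zero, add_zero] at A
    refine A.congr' <| (eventually_ne_atTop 0).mono fun x hx => ?_
    simp only [add_div' _ _ _ hx, div_div_div_cancel_right₀ hx, mul_comm]
  refine ((B.comp tendsto_natCast_atTop_atTop).eventually (gt_mem_nhds hk)).mono fun j hj => ?_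
  refine lt_of_le_of_lt ?_ hj
  have h1 := hmul j r
  have h2 : ((n + ((n + k) * j + r) : ℕ) : ℝ) = j * N + (n + r) := by
    rw [hN]; push_cast; ring
  rw [h2, mul_comm (n + k) j]
  simp only [Function.comp_apply]
  gcongr

variable {d m : ℕ} (p : ProbVector m)

lemma exists_pow_le_valWeight (hd : 0 < d) (hdm : d ≤ m) :
    ∃ c : ℝ, 0 < c ∧ c ≤ 1 ∧ ∀ (k : ℕ) (N : ℤ), 0 ≤ N → N ≤ maxVal d m k →
      c ^ k ≤ valWeight d p k N := by
  obtain ⟨i, hi⟩ := Finite.exists_min p.weight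
  refine ⟨p.weight i, p.pos i, ?_, fun k N h0 h1 => ?_⟩
  · rw [← p.sum_eq_one]
    exact Finset.single_le_sum (fun j _ => (p.pos j).le) (Finset.mem_univ i)
  · obtain ⟨σ, hσ⟩ := exists_val_eq hd hdm k N.toNat (by omega)
    have := wordWeight_le_valWeight (d := d) p σ
    rw [hσ, Int.toNat_of_nonneg h0] at this
    refine le_trans ?_ this
    calc p.weight i ^ k = ∏ _j : Fin k, p.weight i := by simp
      _ ≤ _ := Finset.prod_le_prod (fun _ _ => (p.pos i).le) fun j _ => hi _

lemma maxVal_lt_pow (hd : 0 < d) (hdm : d ≤ m) (k : ℕ) :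
    maxVal d m k + 1 ≤ (m + 1) ^ k := by
  have h : Finset.range (maxVal d m k + 1) ⊆ Finset.univ.image
      (val d : (Fin k → Fin (m + 1)) → ℕ) := by
    intro N hN
    obtain ⟨σ, rfl⟩ := exists_val_eq hd hdm k N (by simpa [Nat.lt_succ_iff] using hN)
    simp
  simpa using (Finset.card_le_card h).trans Finset.card_image_le

lemma exists_log_prefixSum_le {n : ℕ} {v : ℤ} (hd : 1 < d) (hdm : d ≤ m)
    (hv : IsBarrierVal d m n v) (q : ℝ) :
    ∃ C : ℝ, ∀ k, Real.log (prefixSum d p n v k q) ≤ C * ((n + k : ℕ) : ℝ) := by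
  obtain ⟨c, hc0, hc1, hc⟩ := exists_pow_le_valWeight p (by omega : 0 < d) hdm
  -- There are at most (m + 1)^k values, and each weight lies between c^{n+k} and 1, so its q-th
  -- power is at most c^{-|q|(n+k)}.
  refine ⟨Real.log (m + 1) + |q| * (-Real.log c), fun k => ?_⟩
  have hterm : ∀ M ∈ Finset.range (maxVal d m k + 1),
      valWeight d p (n + k) (v * (d : ℤ) ^ k + M) ^ q ≤ (c ^ (n + k)) ^ (-|q|) := by
    intro M hM
    have hb := hv.append hd (M := (M : ℤ)) (k := k) (by omega)
      (by exact_mod_cast Nat.lt_succ_iff.1 (Finset.mem_range.1 hM))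
    have h0 := (hb.nonneg hd hdm).le
    have h1 := hb.le_maxVal hd hdm
    have hW := valWeight_pos p (by omega) hdm h0 h1
    calc _ ≤ valWeight d p (n + k) (v * (d : ℤ) ^ k + M) ^ (-|q|) :=
          Real.rpow_le_rpow_of_exponent_ge hW (valWeight_le_one p _ _) (neg_abs_le q)
      _ ≤ _ := Real.rpow_le_rpow_of_nonpos (by positivity) (hc _ _ h0 h1) (by simp)
  have hsum : prefixSum d p n v k q ≤ ((m + 1 : ℝ)) ^ (n + k) * (c ^ (n + k)) ^ (-|q|) := by
    refine (Finset.sum_le_sum hterm).trans ?_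
    rw [Finset.sum_const, nsmul_eq_mul, Finset.card_range]
    gcongr
    calc ((maxVal d m k + 1 : ℕ) : ℝ) ≤ (m + 1 : ℝ) ^ k := by
          exact_mod_cast maxVal_lt_pow (by omega) hdm k
      _ ≤ _ := pow_le_pow_right₀ (by linarith [(Nat.cast_nonneg m : (0 : ℝ) ≤ m)]) (by omega)
  refine (Real.log_le_log (prefixSum_pos p hd hdm hv k q) hsum).trans (le_of_eq ?_)
  rw [Real.log_mul (by positivity) (by positivity), Real.log_rpow (by positivity), Real.log_pow,
    Real.log_pow]
  ring

/-- The limit `τ̂` exists, and it is the infimum of its approximations. -/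
lemma exists_tau {n : ℕ} {v : ℤ} (hd : 1 < d) (hdm : d ≤ m) (hn : 0 < n)
    (hv : IsBarrierVal d m n v) :
    ∃ τ : ℝ → ℝ, ∀ q : ℝ, Tendsto (fun k : ℕ => delta d * ((n + k : ℕ) : ℝ)⁻¹ *
        Real.log (prefixSum d p n v k q)) atTop (𝓝 (τ q)) ∧
      ∀ k : ℕ, τ q ≤ delta d * ((n + k : ℕ) : ℝ)⁻¹ * Real.log (prefixSum d p n v k q) := by
  have hlog : 0 < Real.log d := Real.log_pos (by exact_mod_cast hd)
  have key : ∀ q : ℝ, ∃ t : ℝ, Tendsto (fun k : ℕ => delta d * ((n + k : ℕ) : ℝ)⁻¹ *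
        Real.log (prefixSum d p n v k q)) atTop (𝓝 t) ∧
      ∀ k : ℕ, t ≤ delta d * ((n + k : ℕ) : ℝ)⁻¹ * Real.log (prefixSum d p n v k q) := by
    intro q
    obtain ⟨C, hC⟩ := exists_log_prefixSum_le p hd hdm hv q
    have heq : (fun k : ℕ => delta d * ((n + k : ℕ) : ℝ)⁻¹ *
        Real.log (prefixSum d p n v k q)) =
        fun k => -(Real.log (prefixSum d p n v k q)) / Real.log d / ((n + k : ℕ) : ℝ) := by
      funext k
      rw [delta]
      ring
    obtain ⟨t, ht, ht'⟩ := exists_tendsto_of_shifted_subadditive hn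
      (fun k => -(Real.log (prefixSum d p n v k q)) / Real.log d) (fun k l => by
        rw [← add_div]
        gcongr
        rw [← neg_add, neg_le_neg_iff, ← Real.log_mul (prefixSum_pos p hd hdm hv _ _).ne'
          (prefixSum_pos p hd hdm hv _ _).ne']
        exact Real.log_le_log (mul_pos (prefixSum_pos p hd hdm hv _ _)
          (prefixSum_pos p hd hdm hv _ _)) (prefixSum_mul_le p hd hdm hv k l q))
      (-C / Real.log d) (fun k => by
        rw [div_mul_eq_mul_div]
        gcongr
        linarith [hC k])
    refine ⟨t, by rwa [heq], fun k => ?_⟩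
    have := congrFun heq k
    rw [this]
    exact ht' k
  choose τ hτ using key
  exact ⟨τ, hτ⟩

/-- For `q ≥ 0` the partition function over all values is controlled by the prefixed one. -/
lemma sum_valWeight_le_prefixSum {n : ℕ} (v : ℤ) {q : ℝ} (hq : 0 ≤ q) (k : ℕ) :
    valWeight d p n v ^ q *
      ∑ M ∈ Finset.range (maxVal d m k + 1), valWeight d p k M ^ q ≤ prefixSum d p n v k q := by
  unfold prefixSum
  rw [Finset.mul_sum]
  refine Finset.sum_le_sum fun M _ => ?_
  rw [← Real.mul_rpow (valWeight_nonneg p _ _) (valWeight_nonneg p _ _)]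
  exact Real.rpow_le_rpow (mul_nonneg (valWeight_nonneg p _ _) (valWeight_nonneg p _ _))
    (valWeight_mul_le p n k v M) hq

/-- The integer form of ξ < 2: shifting a suffix by two or more units of d^k leaves the range of
values. -/
lemma maxVal_lt_two_mul (hd : 3 ≤ d) (hm : m + 2 < 2 * d) (k : ℕ) :
    (maxVal d m k : ℤ) < 2 * (d : ℤ) ^ k := by
  have h3 := maxVal_mul (d := d) (m := m) k
  have hp : (1 : ℤ) ≤ (d : ℤ) ^ k := by exact_mod_cast Nat.one_le_pow _ _ (by omega)
  have : (m : ℤ) < 2 * ((d : ℤ) - 1) := by omega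
  by_contra! h
  have := mul_le_mul_of_nonneg_left h (by omega : (0 : ℤ) ≤ (d : ℤ) - 1)
  nlinarith

/-- The sum of the weights at `M` and its two neighbours at distance `d ^ l` bounds the weight
of every value with suffix `M`. -/
lemma valWeight_add_le_neighbours (hd : 3 ≤ d) (hm : m + 2 < 2 * d) (k l : ℕ) (T M : ℤ)
    (h0 : 0 ≤ M) (hM : M ≤ maxVal d m l) :
    valWeight d p (k + l) (T * (d : ℤ) ^ l + M) ≤
      valWeight d p l (M - (d : ℤ) ^ l) + valWeight d p l M + valWeight d p l (M + (d : ℤ) ^ l) := by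
  rw [valWeight_add]
  set Q := valWeight d p l (M - (d : ℤ) ^ l) + valWeight d p l M +
    valWeight d p l (M + (d : ℤ) ^ l) with hQ
  have hp : (0 : ℤ) < (d : ℤ) ^ l := by positivity
  have h2 := maxVal_lt_two_mul hd hm l
  have n1 := valWeight_nonneg (d := d) p l (M - (d : ℤ) ^ l)
  have n2 := valWeight_nonneg (d := d) p l M
  have n3 := valWeight_nonneg (d := d) p l (M + (d : ℤ) ^ l)
  have key : ∀ t : ℤ, valWeight d p l (M + t * (d : ℤ) ^ l) ≤ Q := by
    intro t
    rcases lt_trichotomy t 0 with h | h | h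
    · rcases eq_or_ne t (-1) with rfl | h'
      · rw [neg_one_mul, ← sub_eq_add_neg]; linarith
      · rw [valWeight_eq_zero p (Or.inl (by nlinarith [show t ≤ -2 by omega]))]; linarith
    · subst h; rw [zero_mul, add_zero]; linarith
    · rcases eq_or_ne t 1 with rfl | h'
      · rw [one_mul]; linarith
      · rw [valWeight_eq_zero p (Or.inr (by nlinarith [show 2 ≤ t by omega]))]; linarith
  calc _ ≤ ∑ σ : Fin k → Fin (m + 1), wordWeight p σ * Q :=
        Finset.sum_le_sum fun σ _ => mul_le_mul_of_nonneg_left (by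
          have := key (T - val d σ)
          rwa [show M + (T - val d σ) * (d : ℤ) ^ l =
            T * (d : ℤ) ^ l + M - val d σ * (d : ℤ) ^ l by ring] at this)
          (wordWeight_pos p σ).le
    _ = Q := by rw [← Finset.sum_mul, sum_wordWeight, one_mul]

/-- Interior prefixes dominate: if `0 < u < maxVal`, then the weight of every value with prefix
`u` is at least a fixed multiple of the weight of the value with the same suffix and any other
prefix. -/
lemma exists_mul_valWeight_le (hd : 3 ≤ d) (hdm : d ≤ m) (hm : m + 2 < 2 * d) {j : ℕ} {u : ℤ}
    (hu0 : 0 < u) (hu1 : u < maxVal d m j) :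
    ∃ c : ℝ, 0 < c ∧ ∀ (n : ℕ) (v : ℤ) (l : ℕ) (M : ℤ), 0 ≤ M → M ≤ maxVal d m l →
      c * valWeight d p (n + l) (v * (d : ℤ) ^ l + M) ≤
        valWeight d p (j + l) (u * (d : ℤ) ^ l + M) := by
  obtain ⟨c, hc0, hc1, hc⟩ := exists_pow_le_valWeight p (by omega : 0 < d) hdm
  -- The factor 3 counts the shifts -1, 0, 1. As u is interior, u - t is an admissible prefix value
  -- for each such t, with weight at least c^j.
  refine ⟨c ^ j / 3, by positivity, fun n v l M h0 hM => ?_⟩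
  have h1 := valWeight_add_le_neighbours p hd hm n l v M h0 hM
  have key : ∀ t : ℤ, -1 ≤ t → t ≤ 1 → c ^ j * valWeight d p l (M + t * (d : ℤ) ^ l) ≤
      valWeight d p (j + l) (u * (d : ℤ) ^ l + M) := by
    intro t ht0 ht1
    have := valWeight_mul_le (d := d) p j l (u - t) (M + t * (d : ℤ) ^ l)
    rw [show (u - t) * (d : ℤ) ^ l + (M + t * (d : ℤ) ^ l) = u * (d : ℤ) ^ l + M by ring] at this
    exact (mul_le_mul_of_nonneg_right (hc j (u - t) (by omega) (by omega))
      (valWeight_nonneg p _ _)).trans this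
  have k1 := key (-1) (by omega) (by omega)
  have k2 := key 0 (by omega) (by omega)
  have k3 := key 1 (by omega) (by omega)
  rw [neg_one_mul, ← sub_eq_add_neg] at k1
  rw [zero_mul, add_zero] at k2
  rw [one_mul] at k3
  have := mul_le_mul_of_nonneg_left h1 (show 0 ≤ c ^ j / 3 by positivity)
  linarith

end

/-! ### Transfer matrices, spectral radii and the two end points. -/

section

variable {d m : ℕ}

lemma halfWidth_eq_one (hd : 3 ≤ d) (hm : m + 2 < 2 * d) : halfWidth d m = 1 := by
  unfold halfWidth
  rw [Nat.div_eq_of_lt (by omega)]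

/-- The matrices whose entries are the weights around a value of words of length `L`. -/
def IsWeightMatrix (d : ℕ) {m : ℕ} (p : ProbVector m) (L : ℕ) (A : Matrix (Idx d m) (Idx d m) ℝ) :
    Prop :=
  ∃ N : ℤ, 0 ≤ N ∧ N ≤ maxVal d m L ∧
    ∀ i j, A i j = valWeight d p L (N + i - j * (d : ℤ) ^ L)

variable (p : ProbVector m)

lemma valWeight_one (N : ℤ) : valWeight d p 1 N = p.ext N := by
  unfold valWeight ProbVector.ext
  rw [← (Equiv.funUnique (Fin 1) (Fin (m + 1))).symm.sum_comp]
  have h : ∀ i : Fin (m + 1), val d ((Equiv.funUnique (Fin 1) (Fin (m + 1))).symm i) = i := by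
    intro i; simp [val]
  simp_rw [h]
  have h' : ∀ i : Fin (m + 1), wordWeight p ((Equiv.funUnique (Fin 1) (Fin (m + 1))).symm i) =
      p.weight i := by
    intro i; simp [wordWeight]
  simp_rw [h']
  split_ifs with hN
  · rw [Finset.sum_eq_single ⟨N.toNat, by omega⟩]
    · rw [if_pos]; simp only; omega
    · intro i _ hi
      rw [if_neg]
      rintro rfl
      exact hi (Fin.ext (by simp))
    · simp
  · refine Finset.sum_eq_zero fun i _ => if_neg fun h => hN ?_
    have := i.2
    omega

lemma isWeightMatrix_one : IsWeightMatrix d p 0 1 := by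
  refine ⟨0, le_rfl, by simp, fun i j => ?_⟩
  have h : valWeight d p 0 (0 + (i : ℤ) - j * (d : ℤ) ^ 0) = if i = j then 1 else 0 := by
    unfold valWeight
    simp only [val, wordWeight, Finset.univ_eq_empty, Finset.sum_empty, Finset.prod_empty]
    rw [Fintype.sum_unique]
    congr 1
    refine propext ⟨fun h => Subtype.ext ?_, ?_⟩
    · simp at h; omega
    · rintro rfl; simp
  rw [h, Matrix.one_apply]

/-- Left multiplication appends the digit i, replacing N by dN + i. Conditioning on all digits but
the last, only prefix values within 1 of N - l d^L leave a remainder in {0, …, m}, because m < 2d -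
2; the index set {-1, 0, 1} is therefore closed under the recursion. -/
lemma IsWeightMatrix.transfer_mul (hd : 3 ≤ d) (hm : m + 2 < 2 * d)
    {L : ℕ} {A : Matrix (Idx d m) (Idx d m) ℝ} (hA : IsWeightMatrix d p L A) (i : Fin (m + 1)) :
    IsWeightMatrix d p (L + 1) (transfer d p i * A) := by
  obtain ⟨N, h0, h1, hN⟩ := hA
  have hw := halfWidth_eq_one hd hm
  refine ⟨d * N + i, by positivity, ?_, fun k l => ?_⟩
  · rw [maxVal_add, maxVal_one]
    push_cast
    have := i.2
    nlinarith
  · rw [Matrix.mul_apply, valWeight_add]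
    set K := N - l * (d : ℤ) ^ L with hK
    set c : ℤ := (k : ℤ) + (i : ℕ) with hc
    have hk : -1 ≤ (k : ℤ) ∧ (k : ℤ) ≤ 1 := by
      have := Finset.mem_Icc.1 k.2
      omega
    have hi := i.2
    have e1 : ∑ σ : Fin L → Fin (m + 1), wordWeight p σ *
        valWeight d p 1 (d * N + (i : ℕ) + k - l * (d : ℤ) ^ (L + 1) - val d σ * (d : ℤ) ^ 1) =
        ∑ σ : Fin L → Fin (m + 1), wordWeight p σ *
          (fun t : ℤ => p.ext (c - (t - K) * d)) (val d σ) := by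
      refine Finset.sum_congr rfl fun σ _ => ?_
      rw [valWeight_one]
      congr 2
      rw [hK, hc]; ring
    refine (e1.trans ((sum_wordWeight_mul (d := d) p L (fun t : ℤ => p.ext (c - (t - K) * d))
      (Finset.univ.image fun r : Idx d m => K + r) fun t ht => ?_).trans ?_)).symm
    · have ht' : t - K < -1 ∨ 1 < t - K := by
        by_contra! h
        refine ht (Finset.mem_image.2 ⟨⟨t - K, ?_⟩, Finset.mem_univ _, by simp⟩)
        rw [hw]
        exact Finset.mem_Icc.2 ⟨by simpa using h.1, by simpa using h.2⟩
      unfold ProbVector.ext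
      rw [dif_neg]
      rintro ⟨g1, g2⟩
      rcases ht' with h | h
      · have : (t - K) * (d : ℤ) ≤ -2 * d := mul_le_mul_of_nonneg_right (by omega) (by omega)
        omega
      · have : 2 * (d : ℤ) ≤ (t - K) * d := mul_le_mul_of_nonneg_right (by omega) (by omega)
        omega
    · rw [Finset.sum_image fun r _ r' _ h => Subtype.ext (by simpa using h)]
      refine Finset.sum_congr rfl fun r _ => ?_
      rw [hN, mul_comm]
      congr 1
      · change p.ext _ = p.ext _
        congr 1
        rw [hc]; ring
      · congr 1
        rw [hK]; ring

lemma isWeightMatrix_prod (hd : 3 ≤ d) (hm : m + 2 < 2 * d) (s : List (Fin (m + 1))) :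
    IsWeightMatrix d p s.length (s.map (transfer d p)).prod := by
  induction s with
  | nil => exact isWeightMatrix_one p
  | cons i s ih =>
    rw [List.map_cons, List.prod_cons]
    exact ih.transfer_mul p hd hm i

lemma isWeightMatrix_prod_pow (hd : 3 ≤ d) (hm : m + 2 < 2 * d) (s : List (Fin (m + 1)))
    (j : ℕ) : IsWeightMatrix d p (j * s.length) ((s.map (transfer d p)).prod ^ j) := by
  have := isWeightMatrix_prod p hd hm (List.replicate j s).flatten
  simpa [List.map_flatten, List.prod_flatten] using this

open scoped Matrix.Norms.Operator

variable {ι : Type} [Fintype ι] [DecidableEq ι]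

lemma rho_eq_ofReal [Nonempty ι] (A : Matrix ι ι ℝ) :
    spectralRadius ℂ (A.map (algebraMap ℝ ℂ)) = ENNReal.ofReal (rho A) := by
  unfold rho
  rw [ENNReal.ofReal_toReal]
  exact ((spectrum.spectralRadius_le_nnnorm _).trans_lt ENNReal.coe_lt_top).ne

lemma rho_nonneg (A : Matrix ι ι ℝ) : 0 ≤ rho A := ENNReal.toReal_nonneg

lemma norm_map_algebraMap (A : Matrix ι ι ℝ) : ‖A.map (algebraMap ℝ ℂ)‖ = ‖A‖ := by
  simp [Matrix.linfty_opNorm_def]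

lemma map_algebraMap_pow (A : Matrix ι ι ℝ) (j : ℕ) :
    A.map (algebraMap ℝ ℂ) ^ j = (A ^ j).map (algebraMap ℝ ℂ) := by
  have := map_pow ((algebraMap ℝ ℂ).mapMatrix (m := ι)) A j
  simpa using this.symm

lemma rho_le_norm [Nonempty ι] (A : Matrix ι ι ℝ) : rho A ≤ ‖A‖ := by
  have := spectrum.spectralRadius_le_nnnorm (𝕜 := ℂ) (A.map (algebraMap ℝ ℂ))
  rw [rho_eq_ofReal, ← ENNReal.ofReal_coe_nnreal, coe_nnnorm, norm_map_algebraMap,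
    ENNReal.ofReal_le_ofReal_iff (norm_nonneg _)] at this
  exact this

lemma rho_pow_le_norm [Nonempty ι] (A : Matrix ι ι ℝ) (j : ℕ) : rho A ^ j ≤ ‖A ^ j‖ := by
  rcases eq_or_ne j 0 with rfl | hj
  · simp
  have := spectrum.spectralRadius_pow_le (𝕜 := ℂ) (A.map (algebraMap ℝ ℂ)) j hj
  rw [map_algebraMap_pow, rho_eq_ofReal, rho_eq_ofReal, ← ENNReal.ofReal_pow (rho_nonneg _),
    ENNReal.ofReal_le_ofReal_iff (rho_nonneg _)] at this
  exact this.trans (rho_le_norm _)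

/-- Gelfand's formula for the complexified matrix; the row-sum norm is unchanged by
complexification. -/
lemma eventually_norm_pow_le [Nonempty ι] (A : Matrix ι ι ℝ) {r : ℝ} (hr : rho A < r) :
    ∀ᶠ j in atTop, ‖A ^ j‖ ≤ r ^ j := by
  have h := spectrum.pow_nnnorm_pow_one_div_tendsto_nhds_spectralRadius (A.map (algebraMap ℝ ℂ))
  have hr0 : 0 < r := (rho_nonneg A).trans_lt hr
  have hlt : spectralRadius ℂ (A.map (algebraMap ℝ ℂ)) < ENNReal.ofReal r := by
    rw [rho_eq_ofReal]
    exact (ENNReal.ofReal_lt_ofReal_iff hr0).2 hr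
  filter_upwards [h.eventually (gt_mem_nhds hlt), eventually_gt_atTop 0] with j hj hj0
  rw [map_algebraMap_pow, ← ENNReal.ofReal_coe_nnreal, coe_nnnorm, norm_map_algebraMap,
    ENNReal.ofReal_rpow_of_nonneg (norm_nonneg _) (by positivity),
    ENNReal.ofReal_lt_ofReal_iff hr0] at hj
  have := pow_le_pow_left₀ (by positivity) hj.le j
  rwa [one_div, Real.rpow_inv_natCast_pow (norm_nonneg _) hj0.ne'] at this

lemma norm_row_le (A : Matrix ι ι ℝ) (i : ι) : ∑ j, |A i j| ≤ ‖A‖ := by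
  rw [Matrix.linfty_opNorm_def]
  have := Finset.le_sup (f := fun i : ι => ∑ j, ‖A i j‖₊) (Finset.mem_univ i)
  have h : ((∑ j, ‖A i j‖₊ : NNReal) : ℝ) ≤ _ := NNReal.coe_le_coe.2 this
  simpa using h

lemma exists_norm_row_eq [Nonempty ι] (A : Matrix ι ι ℝ) : ∃ i, ‖A‖ = ∑ j, |A i j| := by
  rw [Matrix.linfty_opNorm_def]
  obtain ⟨i, -, hi⟩ := Finset.exists_mem_eq_sup Finset.univ Finset.univ_nonempty
    (fun i : ι => ∑ j, ‖A i j‖₊)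
  exact ⟨i, by rw [hi]; simp⟩

lemma exists_norm_le_card_mul [Nonempty ι] (A : Matrix ι ι ℝ) :
    ∃ i j, ‖A‖ ≤ Fintype.card ι * |A i j| := by
  obtain ⟨i, hi⟩ := exists_norm_row_eq A
  obtain ⟨j, hj⟩ := Finite.exists_max fun j => |A i j|
  refine ⟨i, j, ?_⟩
  rw [hi]
  calc _ ≤ ∑ _k : ι, |A i j| := Finset.sum_le_sum fun k _ => hj k
    _ = _ := by simp

lemma norm_prod_le_pow [Nonempty ι] {J : Type} {C : ℝ} (hC : 0 ≤ C) (A : J → Matrix ι ι ℝ)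
    (hA : ∀ i, ‖A i‖ ≤ C) (s : List J) : ‖(s.map A).prod‖ ≤ C ^ s.length := by
  induction s with
  | nil => simp
  | cons i s ih =>
    rw [List.map_cons, List.prod_cons, List.length_cons, pow_succ']
    exact (norm_mul_le _ _).trans (mul_le_mul (hA i) ih (norm_nonneg _) hC)

instance : Nonempty (Idx d m) := ⟨⟨0, by simp⟩⟩

/-- If `α` exceeds the lower end point, some product of transfer matrices has a large spectral
radius. -/
lemma exists_rho_gt (hd : 3 ≤ d) {α : ℝ} (hα : alphaLow d p < α) :
    ∃ s : List (Fin (m + 1)), s ≠ [] ∧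
      ((d : ℝ) ^ (-α)) ^ s.length < rho (s.map (transfer d p)).prod := by
  have hd0 : (0 : ℝ) < d := by positivity
  have hlog : 0 < Real.log d := Real.log_pos (by exact_mod_cast (by omega : 1 < d))
  set f : ℕ → ℝ := fun k =>
    (⨆ s : Fin k → Fin (m + 1), rho (List.ofFn fun i => transfer d p (s i)).prod) ^
      (1 / (k : ℝ)) with hf
  obtain ⟨C, hC0, hC⟩ : ∃ C : ℝ, 0 < C ∧ ∀ i : Fin (m + 1), ‖transfer d p i‖ ≤ C := by
    obtain ⟨i, hi⟩ := Finite.exists_max fun i : Fin (m + 1) => ‖transfer d p i‖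
    exact ⟨‖transfer d p i‖ + 1, by positivity, fun j => (hi j).trans (by linarith)⟩
  have hbound : ∀ (k : ℕ) (s : Fin k → Fin (m + 1)),
      rho (List.ofFn fun i => transfer d p (s i)).prod ≤ C ^ k := by
    intro k s
    have h1 := norm_prod_le_pow hC0.le (transfer d p) hC (List.ofFn s)
    rw [List.map_ofFn, List.length_ofFn] at h1
    exact (rho_le_norm _).trans h1
  have hbdd : ∀ k : ℕ, BddAbove (Set.range fun s : Fin k → Fin (m + 1) =>
      rho (List.ofFn fun i => transfer d p (s i)).prod) :=
    fun k => ⟨C ^ k, by rintro _ ⟨s, rfl⟩; exact hbound k s⟩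
  have hup : ∀ᶠ k in atTop, f k ≤ C := by
    filter_upwards [eventually_gt_atTop 0] with k hk
    have h1 : (⨆ s : Fin k → Fin (m + 1), rho (List.ofFn fun i => transfer d p (s i)).prod) ≤
        C ^ k := ciSup_le fun s => hbound k s
    have h2 : 0 ≤ ⨆ s : Fin k → Fin (m + 1), rho (List.ofFn fun i => transfer d p (s i)).prod :=
      Real.iSup_nonneg fun s => rho_nonneg _
    calc f k ≤ (C ^ k) ^ (1 / (k : ℝ)) := Real.rpow_le_rpow h2 h1 (by positivity)
      _ = C := by rw [one_div, Real.pow_rpow_inv_natCast hC0.le hk.ne']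
  -- A positive lower bound makes the real `limsup` and its logarithm meaningful. The (0, 0) entry
  -- of M_0 is p_0, so that of M_0^j is at least p_0^j and ρ(M_0) ≥ p_0.
  have hlow : ∀ᶠ k in atTop, p.weight 0 ≤ f k := by
    filter_upwards [eventually_gt_atTop 0] with k hk
    set A := transfer d p 0 with hA
    let o : Idx d m := ⟨0, by simp⟩
    have hA0 : ∀ i j, 0 ≤ A i j := by
      intro i j
      rw [hA, transfer, ← valWeight_one (d := d)]
      exact valWeight_nonneg p _ _
    have hAo : A o o = p.weight 0 := by
      simp [hA, transfer, o, ProbVector.ext]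
    have hpow : ∀ j : ℕ, (∀ i i', 0 ≤ (A ^ j) i i') ∧ p.weight 0 ^ j ≤ (A ^ j) o o := by
      intro j
      induction j with
      | zero => simp [Matrix.one_apply]; intro i _ i' _; split_ifs <;> norm_num
      | succ j ih =>
        refine ⟨fun i i' => ?_, ?_⟩
        · rw [pow_succ, Matrix.mul_apply]
          exact Finset.sum_nonneg fun r _ => mul_nonneg (ih.1 _ _) (hA0 _ _)
        · rw [pow_succ, pow_succ, Matrix.mul_apply]
          refine le_trans ?_ (Finset.single_le_sum (f := fun r => (A ^ j) o r * A r o)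
            (fun r _ => mul_nonneg (ih.1 _ _) (hA0 _ _)) (Finset.mem_univ o))
          rw [hAo]
          exact mul_le_mul_of_nonneg_right ih.2 (p.pos 0).le
    have hrho : p.weight 0 ≤ rho A := by
      by_contra! h
      obtain ⟨r, hr1, hr2⟩ := exists_between h
      obtain ⟨j, hj, hj0⟩ := ((eventually_norm_pow_le A hr1).and (eventually_gt_atTop 0)).exists
      have h1 := norm_row_le (A ^ j) o
      have h2 := Finset.single_le_sum (f := fun r => |(A ^ j) o r|)
        (fun r _ => abs_nonneg _) (Finset.mem_univ o)
      have h3 := le_abs_self ((A ^ j) o o)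
      have h4 := (hpow j).2
      have h5 := pow_lt_pow_left₀ hr2 ((rho_nonneg _).trans hr1.le) hj0.ne'
      linarith
    have h1 : p.weight 0 ^ k ≤
        ⨆ s : Fin k → Fin (m + 1), rho (List.ofFn fun i => transfer d p (s i)).prod := by
      refine le_trans ?_ (le_ciSup (hbdd k) fun _ => 0)
      simp only [List.ofFn_const, List.prod_replicate]
      have := spectrum.spectralRadius_pow_le (𝕜 := ℂ) (A.map (algebraMap ℝ ℂ)) k hk.ne'
      rw [map_algebraMap_pow, rho_eq_ofReal, rho_eq_ofReal, ← ENNReal.ofReal_pow (rho_nonneg _),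
        ENNReal.ofReal_le_ofReal_iff (rho_nonneg _)] at this
      exact (pow_le_pow_left₀ (p.pos 0).le hrho k).trans this
    calc p.weight 0 = (p.weight 0 ^ k) ^ (1 / (k : ℝ)) := by
          rw [one_div, Real.pow_rpow_inv_natCast (p.pos 0).le hk.ne']
      _ ≤ f k := Real.rpow_le_rpow (pow_nonneg (p.pos 0).le _) h1 (by positivity)
  have hg0 : 0 < genSpectralRadius (transfer d p) :=
    (p.pos 0).trans_le (le_limsup_of_frequently_le hlow.frequently ⟨C, eventually_map.2 hup⟩)
  have hg : (d : ℝ) ^ (-α) < genSpectralRadius (transfer d p) := by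
    rw [← Real.log_lt_log_iff (by positivity) hg0, Real.log_rpow hd0]
    unfold alphaLow delta at hα
    rw [div_mul_eq_mul_div, div_lt_iff₀ hlog] at hα
    linarith
  have hfreq : ∃ᶠ k in atTop, (d : ℝ) ^ (-α) < f k :=
    frequently_lt_of_lt_limsup (IsCoboundedUnder.of_frequently_ge hlow.frequently) hg
  obtain ⟨k, hk, hk0⟩ := (hfreq.and_eventually (eventually_gt_atTop 0)).exists
  have h2 : 0 ≤ ⨆ s : Fin k → Fin (m + 1), rho (List.ofFn fun i => transfer d p (s i)).prod :=
    Real.iSup_nonneg fun s => rho_nonneg _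
  have h3 := pow_lt_pow_left₀ hk (by positivity) hk0.ne'
  simp only [hf] at h3
  rw [one_div, Real.rpow_inv_natCast_pow h2 hk0.ne'] at h3
  obtain ⟨s, hs⟩ := exists_lt_of_lt_ciSup h3
  refine ⟨List.ofFn s, ?_, ?_⟩
  · intro h
    have := congrArg List.length h
    simp at this
    omega
  · rw [List.length_ofFn, List.map_ofFn]
    exact hs

lemma exists_rho_lt (hd : 3 ≤ d) (hdm : d ≤ m) {α : ℝ} (hα : α < alphaStar d p) :
    ∃ s : List (Fin (m + 1)), s ≠ [] ∧
      rho (s.map (transfer d p)).prod < ((d : ℝ) ^ (-α)) ^ s.length := by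
  have hd0 : (0 : ℝ) < d := by positivity
  have hlog : 0 < Real.log d := Real.log_pos (by exact_mod_cast (by omega : 1 < d))
  set S := {r : ℝ | ∃ (k : ℕ) (σ : Fin (k + 1) → Fin (m + 1)), σ 0 ≠ 0 ∧ σ 0 ≠ Fin.last m ∧
    r = rho (wordTransfer d p σ) ^ (1 / ((k : ℝ) + 1))} with hS
  have hne : S.Nonempty := by
    refine ⟨_, 0, fun _ => ⟨1, by omega⟩, ?_, ?_, rfl⟩
    · simp [Fin.ext_iff]
    · simp [Fin.ext_iff]; omega
  have hS0 : 0 ≤ lowerSpectralRadius d p := by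
    refine le_csInf hne ?_
    rintro _ ⟨k, σ, -, -, rfl⟩
    exact Real.rpow_nonneg (rho_nonneg _) _
  -- The value 0 is treated apart, since `Real.log 0 = 0` would make the logarithmic comparison say
  -- nothing.
  have hlt : lowerSpectralRadius d p < (d : ℝ) ^ (-α) := by
    rcases hS0.eq_or_lt with h | h
    · rw [← h]; positivity
    · rw [← Real.log_lt_log_iff h (by positivity), Real.log_rpow hd0]
      unfold alphaStar delta at hα
      rw [div_mul_eq_mul_div, lt_div_iff₀ hlog] at hα
      linarith
  obtain ⟨_, ⟨k, σ, -, -, rfl⟩, hk⟩ := exists_lt_of_csInf_lt hne hlt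
  -- `wordTransfer` multiplies the letters in reverse order.
  refine ⟨(List.ofFn σ).reverse, by simp, ?_⟩
  have e : ((List.ofFn σ).reverse.map (transfer d p)).prod = wordTransfer d p σ := by
    rw [wordTransfer, List.map_reverse, List.map_ofFn]
    rfl
  rw [e, List.length_reverse, List.length_ofFn]
  have := pow_lt_pow_left₀ hk (Real.rpow_nonneg (rho_nonneg _) _) (Nat.succ_ne_zero k)
  rwa [show 1 / ((k : ℝ) + 1) = ((k + 1 : ℕ) : ℝ)⁻¹ by push_cast; ring, Nat.succ_eq_add_one,
    Real.rpow_inv_natCast_pow (rho_nonneg _) (Nat.succ_ne_zero k)] at this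

/-- A prefixed value whose weight is larger than `d ^ (-α L)`. -/
lemma exists_valWeight_gt {n : ℕ} {v : ℤ} (hd : 3 ≤ d) (hdm : d ≤ m) (hm : m + 2 < 2 * d)
    (hv : IsBarrierVal d m n v) {α : ℝ} (hα : alphaLow d p < α) :
    ∃ (k M : ℕ), M ≤ maxVal d m k ∧
      ((d : ℝ) ^ (-α)) ^ (n + k) < valWeight d p (n + k) (v * (d : ℤ) ^ k + M) := by
  obtain ⟨s, hs, hrho⟩ := exists_rho_gt p hd hα
  set θ : ℝ := (d : ℝ) ^ (-α) with hθ
  have hθ0 : 0 < θ := by positivity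
  set A := (s.map (transfer d p)).prod with hA
  have hWv : 0 < valWeight d p n v := valWeight_pos p (by omega) hdm
    (hv.nonneg (by omega) hdm).le (hv.le_maxVal (by omega) hdm)
  set c : ℝ := (Fintype.card (Idx d m) : ℝ) with hc
  have hc0 : 0 < c := by rw [hc]; exact_mod_cast Fintype.card_pos
  have hx : 1 < rho A / θ ^ s.length := (one_lt_div (by positivity)).2 hrho
  -- The power j absorbs the two fixed losses: the weight of the prefix v, and the factor `card`
  -- between the norm of A^j and its largest entry, which is a weight.
  obtain ⟨j, hj⟩ := pow_unbounded_of_one_lt (θ ^ n * c / valWeight d p n v) hx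
  obtain ⟨i, i', hi⟩ := exists_norm_le_card_mul (A ^ j)
  obtain ⟨N, h0, h1, hN⟩ := isWeightMatrix_prod_pow p hd hm s j
  rw [hN, abs_of_nonneg (valWeight_nonneg p _ _)] at hi
  set T := N + i - i' * (d : ℤ) ^ (j * s.length) with hT
  have h2 : rho A ^ j ≤ c * valWeight d p (j * s.length) T := (rho_pow_le_norm A j).trans hi
  have hrho0 : 0 < rho A := (by positivity : 0 < θ ^ s.length).trans hrho
  have hpos : 0 < valWeight d p (j * s.length) T := by
    have := (pow_pos hrho0 j).trans_le h2
    exact pos_of_mul_pos_right this hc0.le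
  obtain ⟨hT0, hT1⟩ := valWeight_mem_range p hpos
  refine ⟨j * s.length, T.toNat, by omega, ?_⟩
  rw [Int.toNat_of_nonneg hT0]
  refine lt_of_lt_of_le ?_ (valWeight_mul_le p n _ v T)
  rw [div_pow, ← pow_mul, div_lt_div_iff₀ hWv (by positivity), mul_comm s.length] at hj
  have h3 : θ ^ (n + j * s.length) * c <
      valWeight d p n v * valWeight d p (j * s.length) T * c := by
    calc _ = θ ^ n * c * θ ^ (j * s.length) := by rw [pow_add]; ring
      _ < rho A ^ j * valWeight d p n v := hj
      _ ≤ c * valWeight d p (j * s.length) T * valWeight d p n v := by gcongr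
      _ = _ := by ring
  exact lt_of_mul_lt_mul_right h3 hc0.le

/-- A prefixed value whose weight is smaller than `d ^ (-α L)`. -/
lemma exists_valWeight_lt (n : ℕ) (v : ℤ) (hd : 3 ≤ d) (hdm : d ≤ m) (hm : m + 2 < 2 * d)
    {α : ℝ} (hα : α < alphaStar d p) :
    ∃ (k M : ℕ), M ≤ maxVal d m k ∧
      valWeight d p (n + k) (v * (d : ℤ) ^ k + M) < ((d : ℝ) ^ (-α)) ^ (n + k) := by
  obtain ⟨s, hs, hrho⟩ := exists_rho_lt p hd hdm hα
  set θ : ℝ := (d : ℝ) ^ (-α) with hθ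
  have hθ0 : 0 < θ := by positivity
  set A := (s.map (transfer d p)).prod with hA
  obtain ⟨r, hr1, hr2⟩ := exists_between hrho
  have hr0 : 0 < r := (rho_nonneg A).trans_lt hr1
  have hlim : ∀ᶠ j in atTop, (r / θ ^ s.length) ^ j < θ ^ n :=
    (tendsto_pow_atTop_nhds_zero_of_lt_one (by positivity)
      ((div_lt_one (by positivity)).2 hr2)).eventually (gt_mem_nhds (by positivity))
  obtain ⟨j, hj, hj'⟩ := (hlim.and (eventually_norm_pow_le A hr1)).exists
  obtain ⟨N, h0, h1, hN⟩ := isWeightMatrix_prod_pow p hd hm s j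
  refine ⟨j * s.length, N.toNat, by omega, ?_⟩
  rw [Int.toNat_of_nonneg h0]
  refine (valWeight_add_le_neighbours p hd hm n _ v N h0 h1).trans_lt ?_
  have hw := halfWidth_eq_one hd hm
  -- Row 0 of A^j consists of the weights at N and N ± d^{j|s|}, the three that bound any prefixed
  -- weight with suffix N.
  let o : Idx d m := ⟨0, by simp⟩
  have hrow := (norm_row_le (A ^ j) o).trans hj'
  have e : ∑ i : Idx d m, |(A ^ j) o i| = ∑ t ∈ ({-1, 0, 1} : Finset ℤ),
      valWeight d p (j * s.length) (N - t * (d : ℤ) ^ (j * s.length)) := by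
    have hF : ({-1, 0, 1} : Finset ℤ) = Finset.Icc (-(halfWidth d m : ℤ)) (halfWidth d m : ℤ) := by
      rw [hw]; rfl
    rw [hF]
    refine Eq.trans ?_ (Finset.sum_coe_sort _ _)
    refine Finset.sum_congr rfl fun i _ => ?_
    rw [hN, abs_of_nonneg (valWeight_nonneg p _ _)]
    simp [o]
  rw [e] at hrow
  simp at hrow
  rw [div_pow, ← pow_mul, div_lt_iff₀ (by positivity), mul_comm s.length, ← pow_add] at hj
  linarith

end

/-! ### Digit expansions in a general base, and the measure of balls. -/

section

/-- The number with base-`b` digits `u`, where the digits are arbitrary natural numbers. -/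
def expansion (b : ℕ) (u : ℕ → ℕ) : ℝ := ∑' i, (u i : ℝ) / (b : ℝ) ^ (i + 1)

/-- The integer with base-`b` digits `u 0, …, u (k - 1)`. -/
def prefixVal (b : ℕ) (u : ℕ → ℕ) (k : ℕ) : ℕ := ∑ i ∈ Finset.range k, u i * b ^ (k - 1 - i)

lemma prefixVal_zero (b : ℕ) (u : ℕ → ℕ) : prefixVal b u 0 = 0 := by simp [prefixVal]

lemma prefixVal_add (b : ℕ) (u : ℕ → ℕ) (k l : ℕ) :
    prefixVal b u (k + l) = prefixVal b u k * b ^ l + prefixVal b (fun i => u (i + k)) l := by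
  unfold prefixVal
  rw [Finset.sum_range_add, Finset.sum_mul]
  congr 1
  · refine Finset.sum_congr rfl fun i hi => ?_
    have := Finset.mem_range.1 hi
    rw [mul_assoc, ← pow_add]
    congr 2
    omega
  · refine Finset.sum_congr rfl fun i hi => ?_
    rw [add_comm k i]
    congr 2
    omega

lemma prefixVal_succ (b : ℕ) (u : ℕ → ℕ) (k : ℕ) :
    prefixVal b u (k + 1) = prefixVal b u k * b + u k := by
  rw [prefixVal_add]
  simp [prefixVal]

lemma sum_div_pow_eq (b : ℕ) (hb : 0 < b) (u : ℕ → ℕ) (k : ℕ) :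
    (∑ i ∈ Finset.range k, (u i : ℝ) / (b : ℝ) ^ (i + 1)) * (b : ℝ) ^ k = prefixVal b u k := by
  have hb' : (b : ℝ) ≠ 0 := by positivity
  induction k with
  | zero => simp [prefixVal]
  | succ k ih =>
    rw [Finset.sum_range_succ, prefixVal_succ, add_mul, pow_succ, ← mul_assoc, ih]
    push_cast
    field_simp

lemma hasSum_const_div_pow {b : ℕ} (hb : 1 < b) (U : ℝ) :
    HasSum (fun i : ℕ => U / (b : ℝ) ^ (i + 1)) (U / ((b : ℝ) - 1)) := by
  have hb1 : (1 : ℝ) < b := by exact_mod_cast hb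
  have hb0 : (0 : ℝ) < b := by linarith
  have h := (hasSum_geometric_of_lt_one (r := (b : ℝ)⁻¹) (by positivity)
    (inv_lt_one_of_one_lt₀ hb1)).mul_left (U / b)
  have hne : (b : ℝ) - 1 ≠ 0 := by linarith
  have e1 : U / b * (1 - (b : ℝ)⁻¹)⁻¹ = U / ((b : ℝ) - 1) := by field_simp
  rw [e1] at h
  have e2 : (fun i : ℕ => U / (b : ℝ) ^ (i + 1)) = fun i => U / b * (b : ℝ)⁻¹ ^ i := by
    funext i
    rw [inv_pow, pow_succ]
    field_simp
  rwa [e2]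

section

variable {b : ℕ} {U : ℝ} {u : ℕ → ℕ}

lemma summable_expansion (hb : 1 < b) (hu : ∀ i, (u i : ℝ) ≤ U) :
    Summable fun i => (u i : ℝ) / (b : ℝ) ^ (i + 1) :=
  Summable.of_nonneg_of_le (fun i => by positivity) (fun i => by gcongr; exact hu i)
    (hasSum_const_div_pow hb U).summable

lemma expansion_nonneg (b : ℕ) (u : ℕ → ℕ) : 0 ≤ expansion b u :=
  tsum_nonneg fun i => by positivity

lemma expansion_le (hb : 1 < b) (hu : ∀ i, (u i : ℝ) ≤ U) :
    expansion b u ≤ U / ((b : ℝ) - 1) := by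
  rw [← (hasSum_const_div_pow hb U).tsum_eq]
  exact (summable_expansion hb hu).tsum_le_tsum (fun i => by gcongr; exact hu i)
    (hasSum_const_div_pow hb U).summable

lemma expansion_mul_pow (hb : 1 < b) (hu : ∀ i, (u i : ℝ) ≤ U) (k : ℕ) :
    expansion b u * (b : ℝ) ^ k = prefixVal b u k + expansion b (fun i => u (i + k)) := by
  have hb' : (b : ℝ) ≠ 0 := by positivity
  unfold expansion
  rw [← (summable_expansion hb hu).sum_add_tsum_nat_add k, add_mul,
    sum_div_pow_eq b (by omega), ← tsum_mul_right]
  congr 1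
  refine tsum_congr fun i => ?_
  rw [show i + k + 1 = (i + 1) + k by ring, pow_add]
  field_simp

lemma le_expansion (hb : 1 < b) (hu : ∀ i, (u i : ℝ) ≤ U) : (u 0 : ℝ) / b ≤ expansion b u := by
  have := (summable_expansion hb hu).le_tsum 0 fun i _ => by positivity
  simpa [expansion] using this

end

variable {d m : ℕ}

lemma digit_le (ω : ℕ → Fin (m + 1)) (i : ℕ) : (((ω i : ℕ) : ℕ) : ℝ) ≤ m := by
  exact_mod_cast Nat.lt_succ_iff.1 (ω i).2

lemma val_restrict (ω : ℕ → Fin (m + 1)) (k : ℕ) :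
    val d (fun i : Fin k => ω i) = prefixVal d (fun i => (ω i : ℕ)) k := by
  rw [val, prefixVal, Finset.sum_range]

lemma prefixVal_le_maxVal (ω : ℕ → Fin (m + 1)) (k : ℕ) :
    prefixVal d (fun i => (ω i : ℕ)) k ≤ maxVal d m k := by
  rw [← val_restrict]
  exact val_le_maxVal _

lemma xi_lt_two (hd : 3 ≤ d) (hm : m + 2 < 2 * d) : xi d m < 2 := by
  have h1 : (3 : ℝ) ≤ d := by exact_mod_cast hd
  have h2 : (m : ℝ) + 2 < 2 * d := by exact_mod_cast hm
  rw [xi, div_lt_iff₀ (by linarith)]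
  linarith

lemma projInf_nonneg (ω : ℕ → Fin (m + 1)) : 0 ≤ projInf d ω := expansion_nonneg _ _

lemma projInf_le_xi (hd : 1 < d) (ω : ℕ → Fin (m + 1)) : projInf d ω ≤ xi d m :=
  expansion_le hd (digit_le ω)

lemma projInf_mul_pow (hd : 1 < d) (ω : ℕ → Fin (m + 1)) (k : ℕ) :
    projInf d ω * (d : ℝ) ^ k =
      prefixVal d (fun i => (ω i : ℕ)) k + projInf d (fun i => ω (i + k)) :=
  expansion_mul_pow hd (digit_le ω) k

lemma continuous_projInf (hd : 1 < d) :
    Continuous (projInf d : (ℕ → Fin (m + 1)) → ℝ) := by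
  refine continuous_tsum (u := fun i => (m : ℝ) / (d : ℝ) ^ (i + 1)) (fun i => ?_)
    (hasSum_const_div_pow hd (m : ℝ)).summable fun i ω => ?_
  · exact ((continuous_of_discreteTopology (f := fun a : Fin (m + 1) => ((a : ℕ) : ℝ))).comp
      (continuous_apply i)).div_const _
  · rw [Real.norm_of_nonneg (by positivity)]
    exact div_le_div_of_nonneg_right (digit_le ω i) (by positivity)

variable (p : ProbVector m)

instance : IsProbabilityMeasure (digitLaw p) := ⟨by
  simp only [digitLaw, Measure.coe_finsetSum, Finset.sum_apply, Measure.smul_apply,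
    measure_univ, smul_eq_mul, mul_one]
  rw [← ENNReal.ofReal_sum_of_nonneg fun i _ => (p.pos i).le, p.sum_eq_one, ENNReal.ofReal_one]⟩

instance : IsProbabilityMeasure (bernoulliMeasure p) := by
  unfold bernoulliMeasure; infer_instance

lemma digitLaw_singleton (i : Fin (m + 1)) : digitLaw p {i} = ENNReal.ofReal (p.weight i) := by
  simp only [digitLaw, Measure.coe_finsetSum, Finset.sum_apply, Measure.smul_apply, smul_eq_mul]
  rw [Finset.sum_eq_single i]
  · simp
  · intro j _ hj; simp [hj]
  · simp

lemma measurableSet_cylinder {k : ℕ} (σ : Fin k → Fin (m + 1)) :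
    MeasurableSet {ω : ℕ → Fin (m + 1) | ∀ i : Fin k, ω i = σ i} := by
  rw [Set.ofPred_forall]
  exact MeasurableSet.iInter fun i =>
    (measurableSet_singleton (σ i)).preimage (measurable_pi_apply (i : ℕ))

lemma bernoulliMeasure_cylinder {k : ℕ} (σ : Fin k → Fin (m + 1)) :
    bernoulliMeasure p {ω | ∀ i : Fin k, ω i = σ i} = ENNReal.ofReal (wordWeight p σ) := by
  have e : {ω : ℕ → Fin (m + 1) | ∀ i : Fin k, ω i = σ i} =
      (Finset.range k : Set ℕ).pi fun i => if h : i < k then {σ ⟨i, h⟩} else Set.univ := by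
    ext ω
    simp only [Set.mem_ofPred_eq, Set.mem_pi, Finset.coe_range, Set.mem_Iio]
    constructor
    · intro h i hi
      rw [dif_pos hi]
      exact h ⟨i, hi⟩
    · intro h i
      have := h i i.2
      rw [dif_pos i.2] at this
      exact this
  rw [e, bernoulliMeasure, Measure.infinitePi_pi, Finset.prod_range, wordWeight,
    ENNReal.ofReal_prod_of_nonneg fun i _ => (p.pos _).le]
  · refine Finset.prod_congr rfl fun i _ => ?_
    rw [dif_pos i.2, digitLaw_singleton]
  · intro i _
    split_ifs <;> measurability

lemma bernoulliMeasure_prefixVal (k : ℕ) (N : ℤ) :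
    (bernoulliMeasure p).real {ω | (prefixVal d (fun i => (ω i : ℕ)) k : ℤ) = N} =
      valWeight d p k N := by
  have e : {ω : ℕ → Fin (m + 1) | (prefixVal d (fun i => (ω i : ℕ)) k : ℤ) = N} =
      ⋃ σ ∈ Finset.univ.filter fun σ : Fin k → Fin (m + 1) => (val d σ : ℤ) = N,
        {ω | ∀ i : Fin k, ω i = σ i} := by
    ext ω
    simp only [Set.mem_ofPred_eq, Finset.mem_filter, Finset.mem_univ, true_and, Set.mem_iUnion,
      exists_prop]
    rw [← val_restrict]
    constructor
    · intro h
      exact ⟨_, h, fun i => rfl⟩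
    · rintro ⟨σ, hσ, h⟩
      rw [← hσ, funext h]
  rw [e, measureReal_biUnion_finset]
  · rw [valWeight, ← Finset.sum_filter]
    refine Finset.sum_congr rfl fun σ _ => ?_
    rw [measureReal_def, bernoulliMeasure_cylinder, ENNReal.toReal_ofReal (wordWeight_pos p σ).le]
  · intro σ _ τ _ hστ
    refine Set.disjoint_left.2 fun ω h1 h2 => hστ (funext fun i => ?_)
    rw [← h1 i, h2 i]
  · exact fun σ _ => measurableSet_cylinder σ

lemma selfSimilarMeasure_closedBall (hd : 1 < d) (x r : ℝ) :
    (selfSimilarMeasure d p).real (Metric.closedBall x r) =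
      (bernoulliMeasure p).real {ω | |projInf d ω - x| ≤ r} := by
  rw [selfSimilarMeasure, map_measureReal_apply (continuous_projInf hd).measurable
    Metric.isClosed_closedBall.measurableSet]
  rfl

/-- After scaling by d^k, a point with prefix value N lies in [N, N + ξ], and ξ < 2 accounts for the
constant 2. -/
lemma valWeight_le_closedBall (hd : 3 ≤ d) (hm : m + 2 < 2 * d) {x r : ℝ} {k : ℕ} {N : ℤ}
    (h : |x * (d : ℝ) ^ k - N| + 2 ≤ r * (d : ℝ) ^ k) :
    valWeight d p k N ≤ (selfSimilarMeasure d p).real (Metric.closedBall x r) := by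
  have hd1 : 1 < d := by omega
  have hp : (0 : ℝ) < (d : ℝ) ^ k := by positivity
  rw [selfSimilarMeasure_closedBall p hd1, ← bernoulliMeasure_prefixVal]
  refine measureReal_mono fun ω hω => ?_
  have h1 := projInf_mul_pow hd1 ω k
  have h2 : ((prefixVal d (fun i => (ω i : ℕ)) k : ℕ) : ℝ) = (N : ℝ) := by
    have : ((prefixVal d (fun i => (ω i : ℕ)) k : ℤ) : ℝ) = N := by rw [hω]
    simpa using this
  have h3 := projInf_nonneg (d := d) fun i => ω (i + k)
  have h4 := (projInf_le_xi hd1 fun i => ω (i + k)).trans (xi_lt_two hd hm).le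
  rw [h2] at h1
  rw [Set.mem_ofPred_eq, ← mul_le_mul_iff_left₀ hp, ← abs_of_pos hp, ← abs_mul, abs_of_pos hp,
    sub_mul, h1]
  refine le_trans ?_ h
  rw [abs_le]
  have h5 := abs_le.1 (le_refl |x * (d : ℝ) ^ k - N|)
  constructor <;> linarith

/-- A union bound: F has to contain every level-k value whose cylinder can meet the ball. -/
lemma closedBall_le_sum (hd : 1 < d) {x r : ℝ} {k : ℕ} (F : Finset ℤ)
    (hF : ∀ (N : ℤ) (y : ℝ), 0 ≤ y → y ≤ xi d m → |N + y - x * (d : ℝ) ^ k| ≤ r * (d : ℝ) ^ k →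
      N ∈ F) :
    (selfSimilarMeasure d p).real (Metric.closedBall x r) ≤ ∑ N ∈ F, valWeight d p k N := by
  have hp : (0 : ℝ) < (d : ℝ) ^ k := by positivity
  rw [selfSimilarMeasure_closedBall p hd]
  simp_rw [← bernoulliMeasure_prefixVal]
  refine (measureReal_mono (fun ω hω => ?_) (measure_ne_top _ _)).trans
    (measureReal_biUnion_finset_le F _)
  have h1 := projInf_mul_pow hd ω k
  rw [Set.mem_ofPred_eq, ← mul_le_mul_iff_left₀ hp, ← abs_of_pos hp, ← abs_mul, abs_of_pos hp,
    sub_mul, h1] at hω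
  simp only [Set.mem_iUnion, Set.mem_ofPred_eq, exists_prop, exists_eq_right']
  exact hF _ _ (projInf_nonneg _) (projInf_le_xi hd _) (by exact_mod_cast hω)

/-- Barrier words in terms of values. -/
lemma IsBarrier.isBarrierVal (hd : 1 < d) {n : ℕ} {w : Fin n → Fin (m + 1)}
    (hw : IsBarrier d w) : IsBarrierVal d m n (val d w) := by
  have hd1 : (0 : ℝ) < (d : ℝ) - 1 := by
    have : (1 : ℝ) < d := by exact_mod_cast hd
    linarith
  have hp : (0 : ℝ) < (d : ℝ) ^ n := by positivity
  -- The barrier condition is tested on the continuations of w by a constant digit; a = m and a = 0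
  -- give its two inequalities.
  have key : ∀ a : Fin (m + 1), ∃ ω : ℕ → Fin (m + 1), (∀ i : Fin n, ω i = w i) ∧
      projInf d ω * (d : ℝ) ^ n = val d w + (a : ℕ) / ((d : ℝ) - 1) := by
    intro a
    let ω : ℕ → Fin (m + 1) := fun i => if h : i < n then w ⟨i, h⟩ else a
    have h1 : ∀ i : Fin n, ω i = w i := fun i => by simp [ω]
    refine ⟨ω, h1, ?_⟩
    rw [projInf_mul_pow hd, ← val_restrict, funext h1]
    congr 1
    rw [← (hasSum_const_div_pow hd ((a : ℕ) : ℝ)).tsum_eq]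
    simp [projInf, ω]
  obtain ⟨ω, h1, h2⟩ := key (Fin.last m)
  obtain ⟨ω', h1', h2'⟩ := key 0
  have b1 := (hw ω h1).1
  have b2 := (hw ω' h1').2.2
  have c1 : projInf d ω * (d : ℝ) ^ n < (d : ℝ) ^ n := by nlinarith
  have c2 : xi d m * (d : ℝ) ^ n < projInf d ω' * (d : ℝ) ^ n + (d : ℝ) ^ n := by nlinarith
  rw [h2, Fin.val_last] at c1
  rw [h2', xi] at c2
  simp only [Fin.val_zero, CharP.cast_eq_zero, zero_div, add_zero] at c2
  rw [← sub_pos] at c1 c2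
  have c1' := mul_pos hd1 c1
  have c2' := mul_pos hd1 c2
  constructor
  · have : ((d : ℝ) - 1) * val d w + m < ((d : ℝ) - 1) * (d : ℝ) ^ n := by
      have : ((d : ℝ) - 1) * (m / ((d : ℝ) - 1)) = m := by field_simp
      linarith
    exact_mod_cast this
  · have : (m : ℝ) * (d : ℝ) ^ n < ((d : ℝ) - 1) * (val d w + (d : ℝ) ^ n) := by
      have : ((d : ℝ) - 1) * (m / ((d : ℝ) - 1) * (d : ℝ) ^ n) = m * (d : ℝ) ^ n := by field_simp
      linarith
    exact_mod_cast this

lemma IsBarrierVal.length_pos (hdm : d ≤ m) {n : ℕ} {v : ℤ} (hv : IsBarrierVal d m n v)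
    (h0 : 0 ≤ v) (hd : 1 < d) : 0 < n := by
  rcases Nat.eq_zero_or_pos n with rfl | h
  · have h1 := hv.1
    rw [pow_zero] at h1
    have : 0 ≤ ((d : ℤ) - 1) * v := mul_nonneg (by omega) h0
    omega
  · exact h

end

/-! ### The upper bound: coverings of the level sets. -/

section

variable {d m : ℕ} (p : ProbVector m)

/-- Bound for the Hausdorff dimension from the number of `d`-adic intervals in a cover. -/
lemma dimH_le_of_card_le (hd : 1 < d) (E : Set ℝ) (β C : ℝ)
    (h : ∀ᶠ k : ℕ in atTop, ∃ F : Finset ℕ, (∀ x ∈ E, ∃ N ∈ F, |x * (d : ℝ) ^ k - N| ≤ 3) ∧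
      (F.card : ℝ) ≤ C * (d : ℝ) ^ (β * k)) :
    dimH E ≤ ENNReal.ofReal β := by
  have hd1 : (1 : ℝ) < d := by exact_mod_cast hd
  have hd0 : (0 : ℝ) < d := by linarith
  -- A total choice of covers, with a junk value at the scales where none is provided.
  have h' : ∀ k : ℕ, ∃ F : Finset ℕ, (∃ F : Finset ℕ,
      (∀ x ∈ E, ∃ N ∈ F, |x * (d : ℝ) ^ k - N| ≤ 3) ∧ (F.card : ℝ) ≤ C * (d : ℝ) ^ (β * k)) →
      (∀ x ∈ E, ∃ N ∈ F, |x * (d : ℝ) ^ k - N| ≤ 3) ∧ (F.card : ℝ) ≤ C * (d : ℝ) ^ (β * k) := by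
    intro k
    by_cases hk : ∃ F : Finset ℕ, (∀ x ∈ E, ∃ N ∈ F, |x * (d : ℝ) ^ k - N| ≤ 3) ∧
      (F.card : ℝ) ≤ C * (d : ℝ) ^ (β * k)
    · exact ⟨hk.choose, fun _ => hk.choose_spec⟩
    · exact ⟨∅, fun h => absurd h hk⟩
  choose F hF using h'
  have hF' := h.mono fun k hk => hF k hk
  set s : NNReal := β.toNNReal with hs
  refine dimH_le_of_hausdorffMeasure_ne_top (d := s) ?_
  have hdiam : ∀ (k : ℕ) (N : ℝ), Metric.ediam (Set.Icc ((N - 3) / (d : ℝ) ^ k)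
      ((N + 3) / (d : ℝ) ^ k)) = ENNReal.ofReal (6 / (d : ℝ) ^ k) := by
    intro k N
    rw [Real.ediam_Icc]
    congr 1
    ring
  have hlim : Tendsto (fun k : ℕ => ENNReal.ofReal (6 / (d : ℝ) ^ k)) atTop (𝓝 0) := by
    rw [← ENNReal.ofReal_zero]
    exact (ENNReal.continuous_ofReal.tendsto 0).comp
      (tendsto_const_nhds.div_atTop (tendsto_pow_atTop_atTop_of_one_lt hd1))
  have hmeas := Measure.hausdorffMeasure_le_liminf_sum (ι := fun k => F k) (s : ℝ) E (l := atTop)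
    (fun k : ℕ => ENNReal.ofReal (6 / (d : ℝ) ^ k)) hlim
    (fun k N => Set.Icc ((((N : ℕ) : ℝ) - 3) / (d : ℝ) ^ k) ((((N : ℕ) : ℝ) + 3) / (d : ℝ) ^ k))
    (Eventually.of_forall fun k N => (hdiam k _).le)
    (hF'.mono fun k hk x hx => by
      obtain ⟨N, hN, hxN⟩ := hk.1 x hx
      have hp : (0 : ℝ) < (d : ℝ) ^ k := by positivity
      refine Set.mem_iUnion.2 ⟨⟨N, hN⟩, ?_⟩
      rw [abs_le] at hxN
      rw [Set.mem_Icc, div_le_iff₀ hp, le_div_iff₀ hp]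
      constructor <;> linarith)
  refine (hmeas.trans_lt (lt_of_le_of_lt (b := ENNReal.ofReal (C * 6 ^ (s : ℝ))) ?_
    ENNReal.ofReal_lt_top)).ne
  refine liminf_le_of_frequently_le' (hF'.mono fun k hk => ?_).frequently
  simp_rw [hdiam]
  rw [Finset.sum_const, Finset.card_univ, Fintype.card_coe, nsmul_eq_mul,
    ENNReal.ofReal_rpow_of_nonneg (by positivity) s.coe_nonneg, ← ENNReal.ofReal_natCast,
    ← ENNReal.ofReal_mul (by positivity)]
  refine ENNReal.ofReal_le_ofReal ?_
  have hC : 0 ≤ C := by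
    have h1 := (Nat.cast_nonneg (F k).card).trans hk.2
    exact nonneg_of_mul_nonneg_left h1 (by positivity)
  rw [Real.div_rpow (by norm_num) (by positivity), ← Real.rpow_natCast, ← Real.rpow_mul hd0.le]
  have h2 : (d : ℝ) ^ (β * k) ≤ (d : ℝ) ^ (k * (s : ℝ)) := by
    refine Real.rpow_le_rpow_of_exponent_le hd1.le ?_
    rw [mul_comm]
    exact mul_le_mul_of_nonneg_left (Real.le_coe_toNNReal β) (Nat.cast_nonneg k)
  rw [mul_div_assoc', div_le_iff₀ (by positivity)]
  calc ((F k).card : ℝ) * 6 ^ (s : ℝ) ≤ C * (d : ℝ) ^ (k * (s : ℝ)) * 6 ^ (s : ℝ) := by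
        gcongr
        exact hk.2.trans (by gcongr)
    _ = _ := by ring

lemma measureReal_closedBall_pos_of_mem_support {μ : Measure ℝ} [IsFiniteMeasure μ] {x r : ℝ}
    (hx : x ∈ μ.support) (hr : 0 < r) : 0 < μ.real (Metric.closedBall x r) := by
  rw [Measure.mem_support_iff_forall] at hx
  exact ENNReal.toReal_pos (hx _ (Metric.closedBall_mem_nhds x hr)).ne' (measure_ne_top _ _)

lemma tendsto_log_closedBall_div {μ : Measure ℝ} (hd : 1 < d) {x α C : ℝ}
    (hx : HasLocalDim μ x α) (hC : 0 < C) :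
    Tendsto (fun k : ℕ => Real.log (μ.real (Metric.closedBall x (C / (d : ℝ) ^ k))) /
      (-(k * Real.log d))) atTop (𝓝 α) := by
  have hd1 : (1 : ℝ) < d := by exact_mod_cast hd
  have hlog : 0 < Real.log d := Real.log_pos hd1
  have hr : Tendsto (fun k : ℕ => C / (d : ℝ) ^ k) atTop (𝓝[>] 0) :=
    tendsto_nhdsWithin_iff.2 ⟨tendsto_const_nhds.div_atTop
      (tendsto_pow_atTop_atTop_of_one_lt hd1), Eventually.of_forall fun k => by
        simp only [Set.mem_Ioi]; positivity⟩
  have h1 := hx.comp hr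
  have hlogr : ∀ k : ℕ, Real.log (C / (d : ℝ) ^ k) = Real.log C - k * Real.log d := by
    intro k
    rw [Real.log_div (by positivity) (by positivity), Real.log_pow]
  have h2 : Tendsto (fun k : ℕ => Real.log (C / (d : ℝ) ^ k) / (-(k * Real.log d)))
      atTop (𝓝 1) := by
    have h3 : Tendsto (fun k : ℕ => 1 - (Real.log C / Real.log d) / (k : ℝ)) atTop (𝓝 (1 - 0)) :=
      tendsto_const_nhds.sub (tendsto_const_nhds.div_atTop tendsto_natCast_atTop_atTop)
    rw [sub_zero] at h3
    refine h3.congr' ?_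
    filter_upwards [eventually_gt_atTop 0] with k hk
    have hk' : (k : ℝ) ≠ 0 := by positivity
    rw [hlogr]
    field_simp
    ring
  have h4 := h1.mul h2
  rw [mul_one] at h4
  refine h4.congr' ?_
  have h5 : ∀ᶠ r : ℝ in 𝓝[>] 0, Real.log r ≠ 0 := by
    filter_upwards [eventually_nhdsWithin_of_eventually_nhds (gt_mem_nhds one_pos),
      self_mem_nhdsWithin] with r hr1 hr0
    exact (Real.log_neg hr0 hr1).ne
  filter_upwards [hr.eventually h5] with k hk
  exact div_mul_div_cancel₀ hk

lemma eventually_closedBall_bounds {μ : Measure ℝ} [IsFiniteMeasure μ] (hd : 1 < d) {x α C ε : ℝ}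
    (hx : x ∈ levelSet μ α) (hC : 0 < C) (hε : 0 < ε) :
    ∀ᶠ k : ℕ in atTop, (d : ℝ) ^ (-(α + ε) * k) ≤ μ.real (Metric.closedBall x (C / (d : ℝ) ^ k)) ∧
      μ.real (Metric.closedBall x (C / (d : ℝ) ^ k)) ≤ (d : ℝ) ^ (-(α - ε) * k) := by
  have hd1 : (1 : ℝ) < d := by exact_mod_cast hd
  have hlog : 0 < Real.log d := Real.log_pos hd1
  have h := tendsto_log_closedBall_div (d := d) hd hx.2 hC
  filter_upwards [h.eventually (lt_mem_nhds (sub_lt_self α hε)),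
    h.eventually (gt_mem_nhds (lt_add_of_pos_right α hε)), eventually_gt_atTop 0] with k h1 h2 hk
  have hpos := measureReal_closedBall_pos_of_mem_support hx.1
    (show 0 < C / (d : ℝ) ^ k by positivity)
  have hneg : -((k : ℝ) * Real.log d) < 0 := neg_neg_of_pos (by positivity)
  rw [lt_div_iff_of_neg hneg] at h1
  rw [div_lt_iff_of_neg hneg] at h2
  constructor
  · rw [← Real.log_le_log_iff (by positivity) hpos, Real.log_rpow (by linarith)]
    nlinarith
  · rw [← Real.log_le_log_iff hpos (by positivity), Real.log_rpow (by linarith)]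
    nlinarith

lemma eventually_prefixSum_le {n : ℕ} {v : ℤ} {q t : ℝ} (hd : 1 < d) (hdm : d ≤ m) (hn : 0 < n)
    (hv : IsBarrierVal d m n v)
    (ht : Tendsto (fun k : ℕ => delta d * ((n + k : ℕ) : ℝ)⁻¹ *
      Real.log (prefixSum d p n v k q)) atTop (𝓝 t)) {ε : ℝ} (hε : 0 < ε) :
    ∀ᶠ k : ℕ in atTop, prefixSum d p n v k q ≤ (d : ℝ) ^ (-(t - ε) * (n + k : ℕ)) := by
  have hd1 : (1 : ℝ) < d := by exact_mod_cast hd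
  have hlog : 0 < Real.log d := Real.log_pos hd1
  filter_upwards [ht.eventually (lt_mem_nhds (sub_lt_self t hε))] with k hk
  have hN : (0 : ℝ) < ((n + k : ℕ) : ℝ) := by positivity
  rw [← Real.log_le_log_iff (prefixSum_pos p hd hdm hv k q) (by positivity),
    Real.log_rpow (by linarith)]
  have e : delta d * ((n + k : ℕ) : ℝ)⁻¹ * Real.log (prefixSum d p n v k q) =
      -Real.log (prefixSum d p n v k q) / (Real.log d * ((n + k : ℕ) : ℝ)) := by
    rw [delta]; field_simp
  rw [e, lt_div_iff₀ (by positivity)] at hk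
  linarith

instance isProbabilityMeasure_selfSimilarMeasure_of_fact [hd : Fact (1 < d)] :
    IsProbabilityMeasure (selfSimilarMeasure d p) :=
  Measure.isProbabilityMeasure_map (continuous_projInf hd.out).measurable.aemeasurable

/-- The upper bound for nonnegative `q`. -/
lemma dimH_levelSet_le_of_nonneg {n : ℕ} {v : ℤ} {q t α s : ℝ} (hd : 3 ≤ d) (hdm : d ≤ m)
    (hm : m + 2 < 2 * d) (hn : 0 < n) (hv : IsBarrierVal d m n v) (hq : 0 ≤ q)
    (ht : Tendsto (fun k : ℕ => delta d * ((n + k : ℕ) : ℝ)⁻¹ *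
      Real.log (prefixSum d p n v k q)) atTop (𝓝 t)) (hs : q * α - t < s) :
    dimH (levelSet (selfSimilarMeasure d p) α) ≤ ENNReal.ofReal s := by
  have hd' : 1 < d := by omega
  have : Fact (1 < d) := ⟨hd'⟩
  have hd1 : (1 : ℝ) < d := by exact_mod_cast hd'
  have hd0 : (0 : ℝ) < d := by linarith
  set μ := selfSimilarMeasure d p with hμ
  obtain ⟨ε, hε, hεs⟩ : ∃ ε : ℝ, 0 < ε ∧ q * (α + ε) - (t - ε) ≤ s :=
    ⟨(s - (q * α - t)) / (q + 1), div_pos (by linarith) (by linarith), by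
      have : (s - (q * α - t)) / (q + 1) * (q + 1) = s - (q * α - t) := by field_simp
      linarith⟩
  -- The bound on ball masses starts at a scale depending on x. Countable stability of dimension
  -- lets that scale be fixed.
  set E : ℕ → Set ℝ := fun K => {x | ∀ k ≥ K,
    (d : ℝ) ^ (-(α + ε) * k) ≤ μ.real (Metric.closedBall x (1 / (d : ℝ) ^ k))} with hE
  have hsub : levelSet μ α ⊆ ⋃ K, E K := by
    intro x hx
    obtain ⟨K, hK⟩ := eventually_atTop.1 (eventually_closedBall_bounds hd' hx one_pos hε)
    exact Set.mem_iUnion.2 ⟨K, fun k hk => (hK k hk).1⟩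
  refine (dimH_mono hsub).trans ?_
  rw [dimH_iUnion]
  refine iSup_le fun K => ?_
  have hWv : 0 < valWeight d p n v := valWeight_pos p (by omega) hdm
    (hv.nonneg (by omega) hdm).le (hv.le_maxVal (by omega) hdm)
  refine (dimH_le_of_card_le hd' (E K) (q * (α + ε) - (t - ε))
    (6 ^ q * (valWeight d p n v ^ q)⁻¹ * (d : ℝ) ^ (-(t - ε) * n)) ?_).trans
    (ENNReal.ofReal_le_ofReal hεs)
  filter_upwards [eventually_prefixSum_le p hd' hdm hn hv ht hε, eventually_ge_atTop K]
    with k hk hkK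
  have hp : (0 : ℝ) < (d : ℝ) ^ k := by positivity
  set D : ℝ := (d : ℝ) ^ (-(α + ε) * k) with hD
  have hD0 : 0 < D := by positivity
  -- The ball of radius d^{-k} meets at most five level-k cylinders, so one of them has weight at
  -- least D / 6. Counting such values is Chebyshev's inequality for the q-th powers.
  refine ⟨(Finset.range (maxVal d m k + 1)).filter fun M : ℕ => D / 6 ≤ valWeight d p k M, ?_, ?_⟩
  · intro x hx
    set a := x * (d : ℝ) ^ k with ha
    have h1 := closedBall_le_sum (x := x) (r := 1 / (d : ℝ) ^ k) (k := k) p hd'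
      (Finset.Icc ⌈a - 3⌉ ⌊a + 1⌋) (fun N y hy0 hy1 hN => by
        have := xi_lt_two hd hm
        rw [one_div, inv_mul_cancel₀ hp.ne', abs_le] at hN
        rw [Finset.mem_Icc, Int.ceil_le, Int.le_floor]
        constructor <;> linarith)
    have h2 := (hx k hkK).trans h1
    obtain ⟨N, hN, hND⟩ : ∃ N ∈ Finset.Icc ⌈a - 3⌉ ⌊a + 1⌋, D / 6 ≤ valWeight d p k N := by
      by_contra! hcon
      have h3 := Finset.sum_le_sum fun N hN => (hcon N hN).le
      rw [Finset.sum_const, Int.card_Icc, nsmul_eq_mul] at h3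
      have h4 : (⌊a + 1⌋ + 1 - ⌈a - 3⌉).toNat ≤ 5 := by
        have h5 : (⌊a + 1⌋ : ℝ) - ⌈a - 3⌉ ≤ 4 := by
          linarith [Int.floor_le (a + 1), Int.le_ceil (a - 3)]
        have h6 : ⌊a + 1⌋ - ⌈a - 3⌉ ≤ 4 := by exact_mod_cast h5
        omega
      have h7 : ((⌊a + 1⌋ + 1 - ⌈a - 3⌉).toNat : ℝ) * (D / 6) ≤ 5 * (D / 6) :=
        mul_le_mul_of_nonneg_right (by exact_mod_cast h4) (by positivity)
      linarith
    obtain ⟨hN0, hN1⟩ := valWeight_mem_range p (lt_of_lt_of_le (by positivity) hND)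
    rw [Finset.mem_Icc, Int.ceil_le, Int.le_floor] at hN
    refine ⟨N.toNat, Finset.mem_filter.2 ⟨Finset.mem_range.2 (by omega), ?_⟩, ?_⟩
    · rwa [Int.toNat_of_nonneg hN0]
    · have : ((N.toNat : ℕ) : ℝ) = (N : ℝ) := by exact_mod_cast Int.toNat_of_nonneg hN0
      rw [this, abs_le]
      constructor <;> linarith [hN.1, hN.2]
  · have h1 := (sum_valWeight_le_prefixSum (d := d) p (n := n) v hq k).trans hk
    have h2 : ((Finset.range (maxVal d m k + 1)).filter
        fun M : ℕ => D / 6 ≤ valWeight d p k M).card * (D / 6) ^ q ≤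
        ∑ M ∈ Finset.range (maxVal d m k + 1), valWeight d p k M ^ q := by
      rw [← nsmul_eq_mul]
      refine (Finset.card_nsmul_le_sum _ (fun M : ℕ => valWeight d p k M ^ q) _ fun M hM =>
        Real.rpow_le_rpow (by positivity) (Finset.mem_filter.1 hM).2 hq).trans ?_
      exact Finset.sum_le_sum_of_subset_of_nonneg (Finset.filter_subset _ _)
        fun M _ _ => Real.rpow_nonneg (valWeight_nonneg p _ _) _
    have hW : 0 < valWeight d p n v ^ q := by positivity
    have h3 := (mul_le_mul_of_nonneg_left h2 hW.le).trans h1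
    have e : 6 ^ q * (valWeight d p n v ^ q)⁻¹ * (d : ℝ) ^ (-(t - ε) * n) *
        (d : ℝ) ^ ((q * (α + ε) - (t - ε)) * k) =
        (d : ℝ) ^ (-(t - ε) * (n + k : ℕ)) / (valWeight d p n v ^ q * (D / 6) ^ q) := by
      rw [Real.div_rpow hD0.le (by norm_num), hD, ← Real.rpow_mul hd0.le]
      rw [show -(t - ε) * ((n + k : ℕ) : ℝ) = -(t - ε) * n + ((q * (α + ε) - (t - ε)) * k +
        -(α + ε) * k * q) by push_cast; ring, Real.rpow_add hd0, Real.rpow_add hd0]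
      field_simp
    rw [e, le_div_iff₀ (by positivity)]
    linarith

/-- A digit sequence none of whose prefix values is interior is constantly `0` or `m`. -/
lemma eq_const_of_forall_prefixVal (hd : 1 < d) (hdm : d ≤ m) (ω : ℕ → Fin (m + 1))
    (h : ∀ j, prefixVal d (fun i => (ω i : ℕ)) j = 0 ∨
      prefixVal d (fun i => (ω i : ℕ)) j = maxVal d m j) :
    ω = (fun _ => 0) ∨ ω = fun _ => Fin.last m := by
  have hm0 : 0 < m := by omega
  have hstep : ∀ j, prefixVal d (fun i => (ω i : ℕ)) (j + 1) =
      prefixVal d (fun i => (ω i : ℕ)) j * d + ω j := prefixVal_succ d _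
  have hmax : ∀ j, maxVal d m (j + 1) = maxVal d m j * d + m := fun j => by
    rw [maxVal_add, maxVal_one, pow_one]
  rcases Nat.lt_or_ge 0 (ω 0 : ℕ) with h0 | h0
  · right
    have key : ∀ j, prefixVal d (fun i => (ω i : ℕ)) (j + 1) = maxVal d m (j + 1) := by
      intro j
      refine (h (j + 1)).resolve_left fun h1 => ?_
      induction j with
      | zero => rw [hstep, prefixVal_zero] at h1; omega
      | succ j ih =>
        rw [hstep] at h1
        have : prefixVal d (fun i => (ω i : ℕ)) (j + 1) * d = 0 := by omega
        exact ih ((Nat.mul_eq_zero.1 this).resolve_right (by omega))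
    funext j
    refine Fin.ext ?_
    rcases j with _ | j
    · have := key 0
      rw [hstep, prefixVal_zero, maxVal_one] at this
      simpa using this
    · have h1 := key (j + 1)
      rw [hstep, key j, hmax (j + 1)] at h1
      simpa using h1
  · left
    have key : ∀ j, prefixVal d (fun i => (ω i : ℕ)) j = 0 := by
      intro j
      induction j with
      | zero => exact prefixVal_zero _ _
      | succ j ih =>
        refine (h (j + 1)).resolve_right fun h1 => ?_
        rw [hstep, ih, hmax] at h1
        rcases Nat.eq_zero_or_pos j with rfl | hj
        · rw [maxVal_zero] at h1; omega
        · have h2 : 0 < maxVal d m j := by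
            obtain ⟨i, rfl⟩ : ∃ i, j = i + 1 := ⟨j - 1, by omega⟩
            rw [hmax]; omega
          have := (ω j).2
          have : maxVal d m j * d ≥ 1 := Nat.mul_pos h2 (by omega)
          omega
    funext j
    have h1 := key (j + 1)
    rw [hstep] at h1
    refine Fin.ext ?_
    rw [Fin.val_zero]
    omega

/-- The upper bound for nonpositive `q`. -/
lemma dimH_levelSet_le_of_nonpos {n : ℕ} {v : ℤ} {q t α s : ℝ} (hd : 3 ≤ d) (hdm : d ≤ m)
    (hm : m + 2 < 2 * d) (hn : 0 < n) (hv : IsBarrierVal d m n v) (hq : q ≤ 0)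
    (ht : Tendsto (fun k : ℕ => delta d * ((n + k : ℕ) : ℝ)⁻¹ *
      Real.log (prefixSum d p n v k q)) atTop (𝓝 t)) (hs : q * α - t < s) :
    dimH (levelSet (selfSimilarMeasure d p) α) ≤ ENNReal.ofReal s := by
  have hd' : 1 < d := by omega
  have : Fact (1 < d) := ⟨hd'⟩
  have hd1 : (1 : ℝ) < d := by exact_mod_cast hd'
  have hd0 : (0 : ℝ) < d := by linarith
  set μ := selfSimilarMeasure d p with hμ
  obtain ⟨ε, hε, hεs⟩ : ∃ ε : ℝ, 0 < ε ∧ q * (α - ε) - (t - ε) ≤ s :=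
    ⟨(s - (q * α - t)) / (1 - q), div_pos (by linarith) (by linarith), by
      have : (s - (q * α - t)) / (1 - q) * (1 - q) = s - (q * α - t) := by
        rw [div_mul_cancel₀]; linarith
      linarith⟩
  -- The index (j, u, K) records an interior value u of the first j digits and the scale from which
  -- the mass bound holds. Radius 5 is 3 for the distance to the value plus 2 for the length of its
  -- cylinder.
  set E : ℕ × ℕ × ℕ → Set ℝ := fun i => {x | (∃ ω : ℕ → Fin (m + 1), projInf d ω = x ∧
    prefixVal d (fun i => (ω i : ℕ)) i.1 = i.2.1) ∧ 0 < i.2.1 ∧ i.2.1 < maxVal d m i.1 ∧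
    ∀ k ≥ i.2.2, μ.real (Metric.closedBall x (5 / (d : ℝ) ^ k)) ≤ (d : ℝ) ^ (-(α - ε) * k)} with hE
  have hsub : levelSet μ α ⊆ {projInf d fun _ : ℕ => (0 : Fin (m + 1)),
      projInf d fun _ : ℕ => Fin.last m} ∪ ⋃ i, E i := by
    intro x hx
    obtain ⟨K, hK⟩ := eventually_atTop.1
      (eventually_closedBall_bounds hd' hx (by norm_num : (0 : ℝ) < 5) hε)
    obtain ⟨ω, rfl⟩ : x ∈ Set.range (projInf d : (ℕ → Fin (m + 1)) → ℝ) := by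
      have hc : IsClosed (Set.range (projInf d : (ℕ → Fin (m + 1)) → ℝ)) :=
        (isCompact_range (continuous_projInf hd')).isClosed
      by_contra hx'
      have h1 := (Measure.mem_support_iff_forall _).1 hx.1 _ (hc.isOpen_compl.mem_nhds hx')
      rw [hμ, selfSimilarMeasure, Measure.map_apply (continuous_projInf hd').measurable
        hc.isOpen_compl.measurableSet] at h1
      simp at h1
    by_cases hc : ∀ j, prefixVal d (fun i => (ω i : ℕ)) j = 0 ∨
      prefixVal d (fun i => (ω i : ℕ)) j = maxVal d m j
    · left
      rcases eq_const_of_forall_prefixVal hd' hdm ω hc with h | h <;> simp [h]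
    · right
      push Not at hc
      obtain ⟨j, h1, h2⟩ := hc
      have h3 := prefixVal_le_maxVal (d := d) ω j
      exact Set.mem_iUnion.2 ⟨(j, prefixVal d (fun i => (ω i : ℕ)) j, K), ⟨ω, rfl, rfl⟩,
        Nat.pos_of_ne_zero h1, lt_of_le_of_ne h3 h2, fun k hk => (hK k hk).2⟩
  refine (dimH_mono hsub).trans ?_
  rw [dimH_union, dimH_countable (Set.Finite.countable (by simp)), dimH_iUnion]
  refine max_le zero_le (iSup_le fun i => ?_)
  obtain ⟨j, u, K⟩ := i
  by_cases hu : 0 < u ∧ u < maxVal d m j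
  swap
  · have : E (j, u, K) = ∅ := by
      ext x
      simp only [hE, Set.mem_ofPred_eq, Set.mem_empty_iff_false, iff_false]
      exact fun h => hu ⟨h.2.1, h.2.2.1⟩
    rw [this, dimH_empty]
    exact zero_le
  obtain ⟨c, hc0, hc⟩ := exists_mul_valWeight_le p hd hdm hm (j := j) (u := u)
    (by exact_mod_cast hu.1) (by exact_mod_cast hu.2)
  refine (dimH_le_of_card_le hd' (E (j, u, K)) (q * (α - ε) - (t - ε))
    (c ^ q * (d : ℝ) ^ (-(t - ε) * (n - j))) ?_).trans (ENNReal.ofReal_le_ofReal hεs)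
  filter_upwards [(tendsto_sub_atTop_nat j).eventually
    (eventually_prefixSum_le p hd' hdm hn hv ht hε), eventually_ge_atTop K, eventually_ge_atTop j]
    with k hk hkK hkj
  obtain ⟨l, rfl⟩ : ∃ l, k = j + l := ⟨k - j, by omega⟩
  rw [add_tsub_cancel_left] at hk
  set D : ℝ := (d : ℝ) ^ (-(α - ε) * (j + l : ℕ)) with hD
  have hD0 : 0 < D := by positivity
  set G := (Finset.range (maxVal d m l + 1)).filter fun M : ℕ =>
    valWeight d p (j + l) ((u : ℤ) * (d : ℤ) ^ l + M) ≤ D with hG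
  refine ⟨G.image fun M => u * d ^ l + M, ?_, ?_⟩
  · rintro x ⟨⟨ω, rfl, hω⟩, -, -, hx⟩
    have h1 := projInf_mul_pow hd' ω (j + l)
    have h3 := projInf_nonneg (d := d) fun i => ω (i + (j + l))
    have h4 := (projInf_le_xi hd' fun i => ω (i + (j + l))).trans (xi_lt_two hd hm).le
    have h2 := prefixVal_add d (fun i => (ω i : ℕ)) j l
    rw [hω] at h2
    have h5 : |projInf d ω * (d : ℝ) ^ (j + l) -
        ((u * d ^ l + prefixVal d (fun i => (ω (i + j) : ℕ)) l : ℕ) : ℝ)| ≤ 3 := by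
      rw [h1, h2, add_sub_cancel_left, abs_le]
      constructor <;> linarith
    refine ⟨_, Finset.mem_image.2 ⟨prefixVal d (fun i => (ω (i + j) : ℕ)) l,
      Finset.mem_filter.2 ⟨Finset.mem_range.2 (Nat.lt_succ_iff.2 (prefixVal_le_maxVal _ _)), ?_⟩,
      rfl⟩, h5⟩
    refine (valWeight_le_closedBall p hd hm ?_).trans (hx (j + l) hkK)
    rw [div_mul_cancel₀ _ (by positivity)]
    push_cast at h5 ⊢
    linarith
  · have hterm : ∀ M ∈ Finset.range (maxVal d m l + 1),
        0 < valWeight d p (n + l) (v * (d : ℤ) ^ l + M) ∧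
        c * valWeight d p (n + l) (v * (d : ℤ) ^ l + M) ≤
          valWeight d p (j + l) ((u : ℤ) * (d : ℤ) ^ l + M) := by
      intro M hM
      have hM' : (M : ℤ) ≤ maxVal d m l := by
        exact_mod_cast Nat.lt_succ_iff.1 (Finset.mem_range.1 hM)
      have hb := hv.append hd' (M := (M : ℤ)) (k := l) (by omega) hM'
      exact ⟨valWeight_pos p (by omega) hdm (hb.nonneg hd' hdm).le (hb.le_maxVal hd' hdm),
        hc n v l M (by omega) hM'⟩
    have h1 : ∑ M ∈ Finset.range (maxVal d m l + 1),
        valWeight d p (j + l) ((u : ℤ) * (d : ℤ) ^ l + M) ^ q ≤ c ^ q * prefixSum d p n v l q := by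
      rw [prefixSum, Finset.mul_sum]
      refine Finset.sum_le_sum fun M hM => ?_
      obtain ⟨g1, g2⟩ := hterm M hM
      -- For q ≤ 0 powers reverse order, so a lower bound on weights with prefix u bounds their sum
      -- by the v-prefixed one.
      rw [← Real.mul_rpow hc0.le g1.le]
      exact Real.rpow_le_rpow_of_nonpos (by positivity) g2 hq
    have h2 : G.card * D ^ q ≤ ∑ M ∈ Finset.range (maxVal d m l + 1),
        valWeight d p (j + l) ((u : ℤ) * (d : ℤ) ^ l + M) ^ q := by
      rw [← nsmul_eq_mul]
      refine (Finset.card_nsmul_le_sum _ (fun M : ℕ =>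
        valWeight d p (j + l) ((u : ℤ) * (d : ℤ) ^ l + M) ^ q) _ fun M hM => ?_).trans ?_
      · obtain ⟨g1, g2⟩ := Finset.mem_filter.1 hM
        obtain ⟨g3, g4⟩ := hterm M g1
        exact Real.rpow_le_rpow_of_nonpos (lt_of_lt_of_le (by positivity) g4) g2 hq
      · exact Finset.sum_le_sum_of_subset_of_nonneg (Finset.filter_subset _ _)
          fun M _ _ => Real.rpow_nonneg (valWeight_nonneg p _ _) _
    have hcq : 0 < c ^ q := by positivity
    have h3 := h2.trans (h1.trans (mul_le_mul_of_nonneg_left hk hcq.le))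
    have e : c ^ q * (d : ℝ) ^ (-(t - ε) * (n - j)) *
        (d : ℝ) ^ ((q * (α - ε) - (t - ε)) * (j + l : ℕ)) =
        c ^ q * (d : ℝ) ^ (-(t - ε) * (n + l : ℕ)) / D ^ q := by
      rw [hD, ← Real.rpow_mul hd0.le, eq_div_iff (by positivity), mul_assoc, mul_assoc,
        ← Real.rpow_add hd0, ← Real.rpow_add hd0]
      congr 2
      push_cast
      ring
    have hcard : ((G.image fun M => u * d ^ l + M).card : ℝ) ≤ G.card := by
      exact_mod_cast Finset.card_image_le
    rw [e, le_div_iff₀ (by positivity)]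
    exact (mul_le_mul_of_nonneg_right hcard (by positivity)).trans h3

/-- The upper bound for the Hausdorff dimension of the level sets. -/
lemma dimH_levelSet_le {n : ℕ} {v : ℤ} {q t α : ℝ} (hd : 3 ≤ d) (hdm : d ≤ m)
    (hm : m + 2 < 2 * d) (hn : 0 < n) (hv : IsBarrierVal d m n v)
    (ht : Tendsto (fun k : ℕ => delta d * ((n + k : ℕ) : ℝ)⁻¹ *
      Real.log (prefixSum d p n v k q)) atTop (𝓝 t)) :
    dimH (levelSet (selfSimilarMeasure d p) α) ≤ ENNReal.ofReal (q * α - t) := by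
  have h : ∀ s, q * α - t < s →
      dimH (levelSet (selfSimilarMeasure d p) α) ≤ ENNReal.ofReal s := by
    intro s hs
    rcases le_total 0 q with hq | hq
    · exact dimH_levelSet_le_of_nonneg p hd hdm hm hn hv hq ht hs
    · exact dimH_levelSet_le_of_nonpos p hd hdm hm hn hv hq ht hs
  refine ge_of_tendsto (f := ENNReal.ofReal) (x := 𝓝[>] (q * α - t))
    (ENNReal.continuous_ofReal.continuousWithinAt) ?_
  exact eventually_nhdsWithin_of_forall h

end

/-! ### Mass distribution, local dimension along geometric scales, strong law. -/

section

/-- A mass distribution principle along a geometric sequence of scales. -/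
lemma le_dimH_image_of_measure_le {Ω : Type*} [MeasurableSpace Ω] (ν : Measure Ω) {X : Ω → ℝ}
    (hX : Measurable X) {G : Set Ω} (hG : ν G ≠ 0) {b κ : ℝ} (hb : 1 < b) (hκ : 0 < κ)
    {s : NNReal} (hs : 0 < s) (J : ℕ)
    (h : ∀ ω ∈ G, ∀ j ≥ J, ν {ω' | |X ω' - X ω| ≤ κ * b⁻¹ ^ j} ≤
      ENNReal.ofReal ((b⁻¹ ^ j) ^ (s : ℝ))) :
    (s : ENNReal) ≤ dimH (X '' G) := by
  have hb0 : 0 < b := by linarith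
  have hbi : b⁻¹ < 1 := inv_lt_one_of_one_lt₀ hb
  have hbi0 : 0 < b⁻¹ := by positivity
  set C : ENNReal := ENNReal.ofReal ((b / κ) ^ (s : ℝ)) with hC
  have hC0 : C ≠ 0 := by
    rw [hC, Ne, ENNReal.ofReal_eq_zero, not_le]; positivity
  have hCt : C ≠ ⊤ := ENNReal.ofReal_ne_top
  set ρ : Measure ℝ := (ν.restrict G).map X with hρ
  have hsmall : ∀ (U : Set ℝ) (j : ℕ), j ≥ J → Metric.ediam U ≤ ENNReal.ofReal (κ * b⁻¹ ^ j) →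
      ρ U ≤ ENNReal.ofReal ((b⁻¹ ^ j) ^ (s : ℝ)) := by
    intro U j hj hU
    have h1 : MeasurableSet (X ⁻¹' closure U) := hX isClosed_closure.measurableSet
    refine (measure_mono subset_closure).trans ?_
    rw [hρ, Measure.map_apply hX isClosed_closure.measurableSet, Measure.restrict_apply h1]
    rcases (X ⁻¹' closure U ∩ G).eq_empty_or_nonempty with he | ⟨ω, hω1, hω2⟩
    · rw [he, measure_empty]; exact zero_le
    · refine (measure_mono ?_).trans (h ω hω2 j hj)
      rintro ω' ⟨hω', -⟩
      have h2 : edist (X ω') (X ω) ≤ ENNReal.ofReal (κ * b⁻¹ ^ j) :=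
        (Metric.edist_le_ediam_of_mem (s := closure U) hω' hω1).trans
          (by rwa [Metric.ediam_closure])
      rw [edist_dist, ENNReal.ofReal_le_ofReal_iff (by positivity), Real.dist_eq] at h2
      exact h2
  have hbound : ∀ U : Set ℝ, Metric.ediam U ≤ ENNReal.ofReal (κ * b⁻¹ ^ J) →
      (C⁻¹ • ρ) U ≤ Metric.ediam U ^ (s : ℝ) := by
    intro U hU
    rw [Measure.smul_apply, smul_eq_mul, mul_comm, ← div_eq_mul_inv, ENNReal.div_le_iff hC0 hCt]
    have hne : Metric.ediam U ≠ ⊤ := (hU.trans_lt ENNReal.ofReal_lt_top).ne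
    set t : ℝ := (Metric.ediam U).toReal with ht
    have hUt : Metric.ediam U = ENNReal.ofReal t := (ENNReal.ofReal_toReal hne).symm
    have ht0 : 0 ≤ t := ENNReal.toReal_nonneg
    have htJ : t ≤ κ * b⁻¹ ^ J := by
      rw [hUt] at hU
      exact (ENNReal.ofReal_le_ofReal_iff (by positivity)).1 hU
    -- A set of diameter zero is covered by every scale, so its mass vanishes. Otherwise its
    -- diameter lies between two consecutive scales, and the lost factor b / κ is absorbed in C.
    rcases ht0.eq_or_lt with h0 | h0
    · have hz : ρ U = 0 := by
        refine le_antisymm (ge_of_tendsto (f := fun j : ℕ => ENNReal.ofReal ((b⁻¹ ^ j) ^ (s : ℝ)))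
          (x := atTop) ?_ ?_) zero_le
        · have h1 := (ENNReal.continuous_ofReal.tendsto (0 ^ (s : ℝ))).comp
            ((tendsto_pow_atTop_nhds_zero_of_lt_one hbi0.le hbi).rpow_const
              (p := (s : ℝ)) (Or.inr s.coe_nonneg))
          rwa [Real.zero_rpow (by positivity), ENNReal.ofReal_zero] at h1
        · filter_upwards [eventually_ge_atTop J] with j hj
          refine hsmall U j hj ?_
          rw [hUt, ← h0, ENNReal.ofReal_zero]
          exact zero_le
      rw [hz]; exact zero_le
    · have htκ : t / κ ≤ 1 := by
        rw [div_le_one hκ]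
        exact htJ.trans (mul_le_of_le_one_right hκ.le (pow_le_one₀ hbi0.le hbi.le))
      obtain ⟨i, hi1, hi2⟩ := exists_nat_pow_near_of_lt_one (div_pos h0 hκ) htκ hbi0 hbi
      rw [div_le_iff₀ hκ, mul_comm] at hi2
      have hi0 : J ≤ i := by
        by_contra! hlt
        have h1 : b⁻¹ ^ J ≤ b⁻¹ ^ (i + 1) := pow_le_pow_of_le_one hbi0.le hbi.le hlt
        rw [lt_div_iff₀ hκ] at hi1
        nlinarith
      refine (hsmall U i hi0 ?_).trans ?_
      · rw [hUt]
        exact ENNReal.ofReal_le_ofReal hi2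
      · rw [hUt, hC, ENNReal.ofReal_rpow_of_nonneg ht0 s.coe_nonneg,
          ← ENNReal.ofReal_mul (by positivity), ← Real.mul_rpow ht0 (by positivity)]
        refine ENNReal.ofReal_le_ofReal (Real.rpow_le_rpow (by positivity) ?_ s.coe_nonneg)
        rw [pow_succ, ← div_eq_mul_inv, div_lt_iff₀ hb0] at hi1
        calc b⁻¹ ^ i ≤ t / κ * b := hi1.le
          _ = t * (b / κ) := by ring
  have hle := Measure.le_hausdorffMeasure (s : ℝ) (C⁻¹ • ρ)
    (ENNReal.ofReal (κ * b⁻¹ ^ J)) (by rw [ENNReal.ofReal_pos]; positivity) hbound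
  refine le_dimH_of_hausdorffMeasure_ne_zero fun h0 => hG ?_
  have h1 : (C⁻¹ • ρ) (X '' G) = 0 := le_antisymm ((hle _).trans h0.le) zero_le
  rw [Measure.smul_apply, smul_eq_mul, mul_eq_zero] at h1
  have h2 : ρ (X '' G) = 0 := h1.resolve_left (ENNReal.inv_ne_zero.2 hCt)
  -- The image need not be measurable; the inequality used holds for every set.
  have h3 : (ν.restrict G) (X ⁻¹' (X '' G)) = 0 :=
    le_antisymm ((Measure.le_map_apply hX.aemeasurable _).trans h2.le) zero_le
  have h4 : (ν.restrict G) G = 0 := measure_mono_null (Set.subset_preimage_image X G) h3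
  rwa [Measure.restrict_apply_self] at h4

/-- A local dimension computed from two-sided bounds along a geometric sequence of scales. -/
lemma tendsto_div_log_of_sandwich {B A c C : ℝ} {F : ℝ → ℝ} {a : ℕ → ℝ} (hB : 1 < B)
    (hc : 0 < c) (hC : 0 < C)
    (hup : ∀ j r, 0 < r → C ≤ r * B ^ j → -F r ≤ a j)
    (hlow : ∀ j r, 0 < r → r * B ^ j < c → a j ≤ -F r)
    (ha : Tendsto (fun j : ℕ => a j / j) atTop (𝓝 A)) :
    Tendsto (fun r => F r / Real.log r) (𝓝[>] 0) (𝓝 (A / Real.log B)) := by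
  have hlog : 0 < Real.log B := Real.log_pos hB
  have ht : Tendsto (fun r : ℝ => -Real.log r) (𝓝[>] 0) atTop :=
    tendsto_neg_atBot_atTop.comp Real.tendsto_log_nhdsGT_zero
  -- With t = -log r, the scale index is a rounding N of (t + κ) / log B. The additive constant and
  -- the rounding do not affect the limit.
  have hkey : ∀ (κ : ℝ) (N : ℝ → ℕ), Tendsto (fun x => (N ((Real.log B)⁻¹ * x) : ℝ) / x) atTop
      (𝓝 (Real.log B)⁻¹) → Tendsto (fun t : ℝ => a (N ((Real.log B)⁻¹ * (t + κ))) / t) atTop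
      (𝓝 (A / Real.log B)) := by
    intro κ N hN
    have hadd : Tendsto (fun t : ℝ => t + κ) atTop atTop :=
      tendsto_atTop_add_const_right _ _ tendsto_id
    have h1 := hN.comp hadd
    have h2 : Tendsto (fun t : ℝ => (t + κ) / t) atTop (𝓝 1) := by
      have h3 : Tendsto (fun t : ℝ => 1 + κ / t) atTop (𝓝 (1 + 0)) :=
        tendsto_const_nhds.add (tendsto_const_nhds.div_atTop tendsto_id)
      rw [add_zero] at h3
      refine h3.congr' ?_
      filter_upwards [eventually_gt_atTop 0] with t ht
      field_simp
    have h3 := h1.mul h2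
    rw [mul_one] at h3
    have h4 : Tendsto (fun t : ℝ => (N ((Real.log B)⁻¹ * (t + κ)) : ℝ) / t) atTop
        (𝓝 (Real.log B)⁻¹) := by
      refine h3.congr' ?_
      filter_upwards [eventually_gt_atTop 0, eventually_gt_atTop (-κ)] with t ht htκ
      have : t + κ ≠ 0 := by linarith
      simp only [Function.comp_apply]
      field_simp
    have h5 : Tendsto (fun t : ℝ => N ((Real.log B)⁻¹ * (t + κ))) atTop atTop := by
      rw [← tendsto_natCast_atTop_iff (R := ℝ)]
      refine (h4.pos_mul_atTop (by positivity) tendsto_id).congr' ?_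
      filter_upwards [eventually_gt_atTop 0] with t ht
      simp only [id]
      field_simp
    have h6 := (ha.comp h5).mul h4
    rw [← div_eq_mul_inv] at h6
    refine h6.congr' ?_
    filter_upwards [h5.eventually (eventually_gt_atTop 0)] with t ht
    have : (N ((Real.log B)⁻¹ * (t + κ)) : ℝ) ≠ 0 := by positivity
    exact div_mul_div_cancel₀ this
  have hceil := (hkey (Real.log C) (fun x => ⌈x⌉₊)
    (tendsto_nat_ceil_mul_div_atTop (by positivity))).comp ht
  -- Subtracting 1 makes the inequality r B^j < c strict.
  have hfloor := (hkey (Real.log c - 1) (fun x => ⌊x⌋₊)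
    (tendsto_nat_floor_mul_div_atTop (by positivity))).comp ht
  have hr1 : ∀ᶠ r : ℝ in 𝓝[>] 0, r < 1 := eventually_nhdsWithin_of_eventually_nhds
    (gt_mem_nhds one_pos)
  have hpow : ∀ j : ℕ, B ^ j = Real.exp (j * Real.log B) := fun j => by
    rw [Real.exp_nat_mul, Real.exp_log (by linarith)]
  refine tendsto_of_tendsto_of_tendsto_of_le_of_le' hfloor hceil ?_ ?_
  · filter_upwards [hr1, self_mem_nhdsWithin,
      ht.eventually (eventually_gt_atTop (-(Real.log c - 1)))] with r h1 h0 h2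
    have hneg : 0 < -Real.log r := neg_pos.2 (Real.log_neg h0 h1)
    simp only [Function.comp_apply]
    rw [← neg_div_neg_eq (F r)]
    refine div_le_div_of_nonneg_right (hlow _ r h0 ?_) hneg.le
    have h3 := Nat.floor_le (show 0 ≤ (Real.log B)⁻¹ * (-Real.log r + (Real.log c - 1)) from
      mul_nonneg (by positivity) (by linarith))
    rw [inv_mul_eq_div, le_div_iff₀ hlog] at h3
    rw [inv_mul_eq_div, hpow, ← Real.log_lt_log_iff (mul_pos h0 (Real.exp_pos _)) hc,
      Real.log_mul (ne_of_gt h0) (Real.exp_pos _).ne', Real.log_exp]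
    linarith
  · filter_upwards [hr1, self_mem_nhdsWithin] with r h1 h0
    have hneg : 0 < -Real.log r := neg_pos.2 (Real.log_neg h0 h1)
    simp only [Function.comp_apply]
    rw [← neg_div_neg_eq (F r)]
    refine div_le_div_of_nonneg_right (hup _ r h0 ?_) hneg.le
    have h3 := Nat.le_ceil ((Real.log B)⁻¹ * (-Real.log r + Real.log C))
    rw [inv_mul_eq_div, div_le_iff₀ hlog] at h3
    rw [inv_mul_eq_div, hpow, ← Real.log_le_log_iff hC (mul_pos h0 (Real.exp_pos _)),
      Real.log_mul (ne_of_gt h0) (Real.exp_pos _).ne', Real.log_exp]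
    linarith

/-- The strong law for the Bernoulli measure. -/
lemma ae_tendsto_average {R : ℕ} (P : ProbVector R) (f : Fin (R + 1) → ℝ) :
    ∀ᵐ ω ∂(bernoulliMeasure P), Tendsto (fun j : ℕ => (∑ i ∈ Finset.range j, f (ω i)) / j) atTop
      (𝓝 (∑ M, P.weight M * f M)) := by
  have hmp : ∀ i : ℕ, MeasurePreserving (fun ω : ℕ → Fin (R + 1) => ω i) (bernoulliMeasure P)
      (digitLaw P) := fun i => measurePreserving_eval_infinitePi (fun _ => digitLaw P) i
  have hf : Measurable f := measurable_of_finite f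
  have hint : Integrable f (digitLaw P) := Integrable.of_finite
  have h := ProbabilityTheory.strong_law_ae_real (μ := bernoulliMeasure P)
    (fun i (ω : ℕ → Fin (R + 1)) => f (ω i)) ((hmp 0).integrable_comp_of_integrable hint)
    (fun i j hij => (ProbabilityTheory.iIndepFun_infinitePi (P := fun _ : ℕ => digitLaw P)
      (X := fun _ => f) fun _ => hf).indepFun hij)
    (fun i => ⟨(hf.comp (hmp i).measurable).aemeasurable,
      (hf.comp (hmp 0).measurable).aemeasurable, by
      change Measure.map (f ∘ fun ω : ℕ → Fin (R + 1) => ω i) _ =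
        Measure.map (f ∘ fun ω : ℕ → Fin (R + 1) => ω 0) _
      rw [← Measure.map_map hf (hmp i).measurable, ← Measure.map_map hf (hmp 0).measurable,
        (hmp i).map_eq, (hmp 0).map_eq]⟩)
  have he : ∫ ω, f (ω 0) ∂(bernoulliMeasure P) = ∑ M, P.weight M * f M := by
    rw [← integral_map (hmp 0).measurable.aemeasurable hf.aestronglyMeasurable, (hmp 0).map_eq,
      integral_fintype hint]
    refine Finset.sum_congr rfl fun M _ => ?_
    rw [measureReal_def, digitLaw_singleton, ENNReal.toReal_ofReal (P.pos M).le, smul_eq_mul]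
  rwa [he] at h

end

/-! ### Barrier-coded points and the lower bound. -/

section

variable {d m L : ℕ} (p : ProbVector m)

/-- The safety distance of barrier values at level `L`. -/
def gap (d L : ℕ) : ℝ := 1 / (((d : ℝ) - 1) * (d : ℝ) ^ L)

lemma gap_pos (hd : 1 < d) : 0 < gap d L := by
  have : (0 : ℝ) < (d : ℝ) - 1 := by
    have : (1 : ℝ) < d := by exact_mod_cast hd
    linarith
  unfold gap
  positivity

section BarrierSequence

variable {u u' : ℕ → ℕ}

lemma le_of_isBarrierVal (hd : 1 < d) (hdm : d ≤ m) (hu : ∀ i, IsBarrierVal d m L (u i)) (i : ℕ) :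
    (u i : ℝ) ≤ (d : ℝ) ^ L - 2 := by
  have := (hu i).lt_pow hd hdm
  have h : (u i : ℝ) + 2 ≤ (d : ℝ) ^ L := by exact_mod_cast this
  linarith

lemma one_lt_pow_of_isBarrierVal (hd : 1 < d) (hdm : d ≤ m)
    (hu : ∀ i, IsBarrierVal d m L (u i)) : 1 < d ^ L := by
  have h1 := (hu 0).lt_pow hd hdm
  have h2 : 0 ≤ ((u 0 : ℕ) : ℤ) := by positivity
  zify
  omega

lemma expansion_mul_pow_of_isBarrierVal (hd : 1 < d) (hdm : d ≤ m)
    (hu : ∀ i, IsBarrierVal d m L (u i)) (j : ℕ) :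
    expansion (d ^ L) u * (d : ℝ) ^ (L * j) =
      prefixVal (d ^ L) u j + expansion (d ^ L) fun i => u (i + j) := by
  have := expansion_mul_pow (one_lt_pow_of_isBarrierVal hd hdm hu)
    (le_of_isBarrierVal hd hdm hu) j
  rwa [Nat.cast_pow, ← pow_mul] at this

/-- Digits are at most B - 2 with B = d^L, so the expansion is at most 1 - 1 / (B - 1), and `gap` is
at most 1 / (B - 1). -/
lemma expansion_le_of_isBarrierVal (hd : 1 < d) (hdm : d ≤ m)
    (hu : ∀ i, IsBarrierVal d m L (u i)) : expansion (d ^ L) u ≤ 1 - gap d L := by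
  have hB := one_lt_pow_of_isBarrierVal hd hdm hu
  have hB' : (1 : ℝ) < (d : ℝ) ^ L := by exact_mod_cast hB
  have hd2 : (2 : ℝ) ≤ d := by exact_mod_cast hd
  have h := expansion_le hB (le_of_isBarrierVal hd hdm hu)
  rw [Nat.cast_pow] at h
  refine h.trans ?_
  have e : ((d : ℝ) ^ L - 2) / ((d : ℝ) ^ L - 1) = 1 - 1 / ((d : ℝ) ^ L - 1) := by
    have : (d : ℝ) ^ L - 1 ≠ 0 := by linarith
    field_simp
    ring
  rw [e, gap]
  have : 1 / (((d : ℝ) - 1) * (d : ℝ) ^ L) ≤ 1 / ((d : ℝ) ^ L - 1) :=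
    one_div_le_one_div_of_le (by linarith) (by nlinarith)
  linarith

/-- The first digit suffices: the barrier inequality is strict between integers, and one unit of
slack becomes `gap` after division by (d - 1) d^L. -/
lemma le_expansion_of_isBarrierVal (hd : 1 < d) (hdm : d ≤ m)
    (hu : ∀ i, IsBarrierVal d m L (u i)) : xi d m - 1 + gap d L ≤ expansion (d ^ L) u := by
  have hB := one_lt_pow_of_isBarrierVal hd hdm hu
  have hd1 : (0 : ℝ) < (d : ℝ) - 1 := by
    have : (1 : ℝ) < d := by exact_mod_cast hd
    linarith
  have hp : (0 : ℝ) < (d : ℝ) ^ L := by positivity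
  have h := le_expansion hB (le_of_isBarrierVal hd hdm hu)
  rw [Nat.cast_pow] at h
  refine le_trans ?_ h
  have h1 : (m : ℤ) * (d : ℤ) ^ L + 1 ≤ ((d : ℤ) - 1) * (u 0 + (d : ℤ) ^ L) := (hu 0).2
  have h2 : (m : ℝ) * (d : ℝ) ^ L + 1 ≤ ((d : ℝ) - 1) * (u 0 + (d : ℝ) ^ L) := by
    exact_mod_cast h1
  rw [xi, gap, le_div_iff₀ hp]
  have e : ((m : ℝ) / ((d : ℝ) - 1) - 1 + 1 / (((d : ℝ) - 1) * (d : ℝ) ^ L)) * (d : ℝ) ^ L =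
      ((m : ℝ) * (d : ℝ) ^ L + 1) / ((d : ℝ) - 1) - (d : ℝ) ^ L := by
    field_simp
    ring
  rw [e, sub_le_iff_le_add, div_le_iff₀ hd1]
  linarith

lemma one_lt_xi (hd : 1 < d) (hdm : d ≤ m) : 1 < xi d m := by
  have hd1 : (0 : ℝ) < (d : ℝ) - 1 := by
    have : (1 : ℝ) < d := by exact_mod_cast hd
    linarith
  have : (d : ℝ) ≤ m := by exact_mod_cast hdm
  rw [xi, lt_div_iff₀ hd1]
  linarith

lemma eq_of_prefixVal_eq {b : ℕ} (hu : ∀ i, u i < b) (hu' : ∀ i, u' i < b) (j : ℕ)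
    (h : prefixVal b u j = prefixVal b u' j) : ∀ i < j, u i = u' i := by
  induction j with
  | zero => intro i hi; omega
  | succ j ih =>
    rw [prefixVal_succ, prefixVal_succ, mul_comm _ b, mul_comm _ b] at h
    have h1 : u j = u' j := by
      have := congrArg (· % b) h
      simpa [Nat.mul_add_mod, Nat.mod_eq_of_lt (hu j), Nat.mod_eq_of_lt (hu' j)] using this
    have h2 : prefixVal b u j = prefixVal b u' j := by
      have h3 : b * prefixVal b u j = b * prefixVal b u' j := by omega
      exact Nat.eq_of_mul_eq_mul_left ((Nat.zero_le _).trans_lt (hu 0)) h3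
    intro i hi
    rcases Nat.lt_succ_iff_lt_or_eq.1 hi with hi | rfl
    · exact ih h2 i hi
    · exact h1

/-- Separation of the points coded by sequences of barrier values. -/
lemma eq_of_abs_expansion_sub_le (hd : 1 < d) (hdm : d ≤ m)
    (hu : ∀ i, IsBarrierVal d m L (u i)) (hu' : ∀ i, IsBarrierVal d m L (u' i)) {j : ℕ}
    (h : |expansion (d ^ L) u - expansion (d ^ L) u'| * (d : ℝ) ^ (L * j) ≤ gap d L) :
    ∀ i < j, u i = u' i := by
  have hlt : ∀ {u : ℕ → ℕ}, (∀ i, IsBarrierVal d m L (u i)) → ∀ i, u i < d ^ L := by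
    intro u hu i
    have := (hu i).lt_pow hd hdm
    zify
    omega
  refine eq_of_prefixVal_eq (hlt hu) (hlt hu') j ?_
  have hg := gap_pos (d := d) (L := L) hd
  have e1 := expansion_mul_pow_of_isBarrierVal hd hdm hu j
  have e2 := expansion_mul_pow_of_isBarrierVal hd hdm hu' j
  have b1 := expansion_le_of_isBarrierVal hd hdm fun i => hu (i + j)
  have b2 := expansion_le_of_isBarrierVal hd hdm fun i => hu' (i + j)
  have c1 := le_expansion_of_isBarrierVal hd hdm fun i => hu (i + j)
  have c2 := le_expansion_of_isBarrierVal hd hdm fun i => hu' (i + j)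
  have hxi := one_lt_xi hd hdm
  have hp : (0 : ℝ) < (d : ℝ) ^ (L * j) := by positivity
  rw [← abs_of_pos hp, ← abs_mul, sub_mul, e1, e2, abs_le] at h
  -- Both tails lie in [ξ - 1 + `gap`, 1 - `gap`], an interval of length less than 1 - 2 `gap`.
  -- Scaled points within `gap` thus have integer parts differing by less than 1.
  have h1 : ((prefixVal (d ^ L) u j : ℕ) : ℝ) < (prefixVal (d ^ L) u' j : ℕ) + 1 := by linarith
  have h2 : ((prefixVal (d ^ L) u' j : ℕ) : ℝ) < (prefixVal (d ^ L) u j : ℕ) + 1 := by linarith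
  have h1' : prefixVal (d ^ L) u j < prefixVal (d ^ L) u' j + 1 := by exact_mod_cast h1
  have h2' : prefixVal (d ^ L) u' j < prefixVal (d ^ L) u j + 1 := by exact_mod_cast h2
  omega

/-- The barrier factorisation, iterated block by block. -/
lemma valWeight_prefixVal (hd : 1 < d) (hu : ∀ i, IsBarrierVal d m L (u i)) (j : ℕ) :
    valWeight d p (L * j) (prefixVal (d ^ L) u j) =
      ∏ i ∈ Finset.range j, valWeight d p L (u i) := by
  induction j with
  | zero => simp [prefixVal_zero, valWeight, val, wordWeight]
  | succ j ih =>
    rw [prefixVal_succ, Finset.prod_range_succ, ← ih, mul_add, mul_one]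
    push_cast
    exact (hu j).valWeight_add p hd _

/-- Points coded by sequences of barrier values with converging averages of the logarithms of
the weights have a local dimension. -/
lemma expansion_mem_levelSet (hd : 3 ≤ d) (hdm : d ≤ m) (hm : m + 2 < 2 * d)
    (hu : ∀ i, IsBarrierVal d m L (u i)) {α : ℝ}
    (hlim : Tendsto (fun j : ℕ => (∑ i ∈ Finset.range j, Real.log (valWeight d p L (u i))) / j)
      atTop (𝓝 (-(α * (L * Real.log d))))) :
    expansion (d ^ L) u ∈ levelSet (selfSimilarMeasure d p) α := by
  have hd' : 1 < d := by omega
  have : Fact (1 < d) := ⟨hd'⟩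
  have hlog : 0 < Real.log d := Real.log_pos (by exact_mod_cast hd')
  have hB := one_lt_pow_of_isBarrierVal hd' hdm hu
  have hB' : (1 : ℝ) < (d : ℝ) ^ L := by exact_mod_cast hB
  have hL : (L : ℝ) ≠ 0 := by
    rintro h
    have : L = 0 := by exact_mod_cast h
    simp [this] at hB
  set x := expansion (d ^ L) u with hx
  set μ := selfSimilarMeasure d p with hμ
  have hW : ∀ i, 0 < valWeight d p L (u i) := fun i =>
    valWeight_pos p (by omega) hdm ((hu i).nonneg hd' hdm).le ((hu i).le_maxVal hd' hdm)
  have hWj : ∀ j, 0 < valWeight d p (L * j) (prefixVal (d ^ L) u j) := fun j => by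
    rw [valWeight_prefixVal p hd' hu]
    exact Finset.prod_pos fun i _ => hW i
  have hg := gap_pos (d := d) (L := L) hd'
  have hxi := one_lt_xi hd' hdm
  -- The scaled tail is below 1 and the cylinder shorter than 2, so three units contain the
  -- cylinder.
  have hlow : ∀ (j : ℕ) (r : ℝ), 3 ≤ r * ((d : ℝ) ^ L) ^ j →
      valWeight d p (L * j) (prefixVal (d ^ L) u j) ≤ μ.real (Metric.closedBall x r) := by
    intro j r hr
    rw [← pow_mul] at hr
    refine valWeight_le_closedBall p hd hm ?_
    rw [expansion_mul_pow_of_isBarrierVal hd' hdm hu, Int.cast_natCast, add_sub_cancel_left]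
    have b1 := expansion_le_of_isBarrierVal hd' hdm fun i => hu (i + j)
    rw [abs_of_nonneg (expansion_nonneg _ _)]
    linarith
  -- Below the safety distance only the cylinder of the coded prefix meets the ball, overlapping
  -- copies included.
  have hup : ∀ (j : ℕ) (r : ℝ), r * ((d : ℝ) ^ L) ^ j < gap d L →
      μ.real (Metric.closedBall x r) ≤ valWeight d p (L * j) (prefixVal (d ^ L) u j) := by
    intro j r hr
    rw [← pow_mul] at hr
    refine (closedBall_le_sum p hd' {((prefixVal (d ^ L) u j : ℕ) : ℤ)} (k := L * j) ?_).trans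
      (by simp)
    intro N y hy0 hy1 hN
    have b1 := expansion_le_of_isBarrierVal hd' hdm fun i => hu (i + j)
    have c1 := le_expansion_of_isBarrierVal hd' hdm fun i => hu (i + j)
    rw [expansion_mul_pow_of_isBarrierVal hd' hdm hu, abs_le] at hN
    have h1 : (N : ℝ) < (prefixVal (d ^ L) u j : ℕ) + 1 := by linarith
    have h2 : ((prefixVal (d ^ L) u j : ℕ) : ℝ) < N + 1 := by linarith
    have h1' : N < (prefixVal (d ^ L) u j : ℕ) + 1 := by exact_mod_cast h1
    have h2' : ((prefixVal (d ^ L) u j : ℕ) : ℤ) < N + 1 := by exact_mod_cast h2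
    rw [Finset.mem_singleton]
    omega
  have hpos : ∀ r : ℝ, 0 < r → 0 < μ.real (Metric.closedBall x r) := by
    intro r hr
    obtain ⟨j, hj⟩ := pow_unbounded_of_one_lt (3 / r) hB'
    rw [div_lt_iff₀ hr] at hj
    exact (hWj j).trans_le (hlow j r (by linarith))
  refine ⟨?_, ?_⟩
  · rw [Measure.mem_support_iff_forall]
    intro U hU
    obtain ⟨r, hr, hrU⟩ := Metric.nhds_basis_closedBall.mem_iff.1 hU
    have := hpos r hr
    rw [measureReal_def] at this
    exact (ENNReal.toReal_pos_iff.1 this).1.trans_le (measure_mono hrU)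
  · have key := tendsto_div_log_of_sandwich (B := (d : ℝ) ^ L) (A := α * (L * Real.log d))
      (c := gap d L) (C := 3) (F := fun r => Real.log (μ.real (Metric.closedBall x r)))
      (a := fun j => -Real.log (valWeight d p (L * j) (prefixVal (d ^ L) u j))) hB' hg
      (by norm_num)
      (fun j r hr h => neg_le_neg (Real.log_le_log (hWj j) (hlow j r h)))
      (fun j r hr h => neg_le_neg (Real.log_le_log (hpos r hr) (hup j r h)))
      (by
        refine (hlim.neg.congr fun j => ?_).trans (by rw [neg_neg])
        rw [valWeight_prefixVal p hd' hu, Real.log_prod fun i _ => (hW i).ne', neg_div])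
    rw [Real.log_pow, mul_div_assoc, div_self (by positivity), mul_one] at key
    exact key

end BarrierSequence

/-- The partition function normalised by the expected exponent `α`. -/
def scaledSum (d : ℕ) {m : ℕ} (p : ProbVector m) (n : ℕ) (v : ℤ) (α : ℝ) (k : ℕ) (q : ℝ) : ℝ :=
  ∑ M : Fin (maxVal d m k + 1),
    (valWeight d p (n + k) (v * (d : ℤ) ^ k + (M : ℕ)) * (d : ℝ) ^ (α * (n + k : ℕ))) ^ q

lemma scaledSum_eq (hd : 0 < d) (n : ℕ) (v : ℤ) (α : ℝ) (k : ℕ) (q : ℝ) :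
    scaledSum d p n v α k q =
      prefixSum d p n v k q * (d : ℝ) ^ (q * α * (n + k : ℕ)) := by
  have hd0 : (0 : ℝ) < d := by exact_mod_cast hd
  rw [scaledSum, prefixSum, Finset.sum_range, Finset.sum_mul]
  refine Finset.sum_congr rfl fun M _ => ?_
  rw [Real.mul_rpow (valWeight_nonneg p _ _) (by positivity), ← Real.rpow_mul hd0.le]
  congr 2
  ring

/-- The lower bound for the Hausdorff dimension at a critical point of the normalised partition
function. -/
lemma le_dimH_levelSet {n k v : ℕ} {α q : ℝ} (hd : 3 ≤ d) (hdm : d ≤ m) (hm : m + 2 < 2 * d)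
    (hn : 0 < n) (hv : IsBarrierVal d m n v)
    (hcrit : ∑ M : Fin (maxVal d m k + 1),
      (valWeight d p (n + k) ((v : ℤ) * (d : ℤ) ^ k + (M : ℕ)) * (d : ℝ) ^ (α * (n + k : ℕ))) ^ q *
        Real.log (valWeight d p (n + k) ((v : ℤ) * (d : ℤ) ^ k + (M : ℕ)) *
          (d : ℝ) ^ (α * (n + k : ℕ))) = 0) :
    (levelSet (selfSimilarMeasure d p) α).Nonempty ∧
      ENNReal.ofReal (Real.log (scaledSum d p n v α k q) / ((n + k : ℕ) * Real.log d)) ≤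
        dimH (levelSet (selfSimilarMeasure d p) α) := by
  have hd' : 1 < d := by omega
  have hd1 : (1 : ℝ) < d := by exact_mod_cast hd'
  have hd0 : (0 : ℝ) < d := by linarith
  have hlog : 0 < Real.log d := Real.log_pos hd1
  set L := n + k with hL
  have hL0 : (0 : ℝ) < (L : ℕ) := by
    have : 0 < L := by omega
    exact_mod_cast this
  set R := maxVal d m k with hR
  set u : Fin (R + 1) → ℕ := fun M => v * d ^ k + M with hu
  have hucast : ∀ M : Fin (R + 1), ((u M : ℕ) : ℤ) = (v : ℤ) * (d : ℤ) ^ k + (M : ℕ) := by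
    intro M; simp [hu]
  simp_rw [← hucast] at hcrit
  have hbar : ∀ M, IsBarrierVal d m L (u M) := by
    intro M
    rw [hucast]
    exact hv.append hd' (by omega) (by exact_mod_cast Nat.lt_succ_iff.1 M.2)
  set a : Fin (R + 1) → ℝ := fun M => valWeight d p L (u M) * (d : ℝ) ^ (α * (L : ℕ)) with ha
  have hW : ∀ M, 0 < valWeight d p L (u M) := fun M => valWeight_pos p (by omega) hdm
    ((hbar M).nonneg hd' hdm).le ((hbar M).le_maxVal hd' hdm)
  have ha0 : ∀ M, 0 < a M := fun M => mul_pos (hW M) (by positivity)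
  set S := scaledSum d p n v α k q with hS
  have hSsum : S = ∑ M, a M ^ q := by
    rw [hS, scaledSum]
    exact Finset.sum_congr rfl fun M _ => by rw [ha]; simp only [hucast]; rfl
  have hS0 : 0 < S := by
    rw [hSsum]
    exact Finset.sum_pos (fun M _ => Real.rpow_pos_of_pos (ha0 M) _) Finset.univ_nonempty
  -- Gibbs weights: `hcrit` states exactly that log a has mean zero under P.
  let P : ProbVector R := ⟨fun M => a M ^ q / S,
    fun M => div_pos (Real.rpow_pos_of_pos (ha0 M) _) hS0, by rw [← Finset.sum_div, ← hSsum, div_self hS0.ne']⟩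
  set ν := bernoulliMeasure P with hν
  set X : (ℕ → Fin (R + 1)) → ℝ := fun ω => expansion (d ^ L) fun i => u (ω i) with hX
  have hbar' : ∀ ω : ℕ → Fin (R + 1), ∀ i, IsBarrierVal d m L (u (ω i)) := fun ω i => hbar _
  have hXm : Measurable X := by
    refine Measurable.tsum fun i => ?_
    exact ((measurable_of_finite fun M : Fin (R + 1) => ((u M : ℕ) : ℝ)).comp
      (measurable_pi_apply i)).div_const _
  have hae := ae_tendsto_average P fun M => Real.log (a M)
  have hmean : ∑ M, P.weight M * Real.log (a M) = 0 := by
    have : ∑ M, P.weight M * Real.log (a M) = (∑ M, a M ^ q * Real.log (a M)) / S := by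
      rw [Finset.sum_div]
      exact Finset.sum_congr rfl fun M _ => by simp only [P]; ring
    rw [this, hcrit, zero_div]
  rw [hmean] at hae
  set Good : Set (ℕ → Fin (R + 1)) := {ω | Tendsto (fun j : ℕ =>
    (∑ i ∈ Finset.range j, Real.log (a (ω i))) / j) atTop (𝓝 0)} with hGood
  have hsub : ∀ ω ∈ Good, X ω ∈ levelSet (selfSimilarMeasure d p) α := by
    intro ω hω
    refine expansion_mem_levelSet p hd hdm hm (hbar' ω) ?_
    have h1 : Tendsto (fun j : ℕ => (∑ i ∈ Finset.range j, Real.log (a (ω i))) / j -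
        α * (L * Real.log d)) atTop (𝓝 (0 - α * (L * Real.log d))) := hω.sub_const _
    rw [zero_sub] at h1
    refine h1.congr' ?_
    filter_upwards [eventually_gt_atTop 0] with j hj
    have hj' : (j : ℝ) ≠ 0 := by positivity
    have h2 : ∀ M, Real.log (a M) = Real.log (valWeight d p L (u M)) + α * (L * Real.log d) := by
      intro M
      rw [ha]
      simp only
      rw [Real.log_mul (hW M).ne' (by positivity), Real.log_rpow hd0]
      ring
    simp_rw [h2]
    rw [Finset.sum_add_distrib, Finset.sum_const, Finset.card_range, nsmul_eq_mul]
    field_simp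
    ring
  have hGood1 : ν Goodᶜ = 0 := hae
  have hGoodne : ν Good ≠ 0 := by
    intro h0
    have := measure_union_null h0 hGood1
    rw [Set.union_compl_self, measure_univ] at this
    exact one_ne_zero this
  refine ⟨?_, ENNReal.le_of_forall_nnreal_lt fun s hs => ?_⟩
  · obtain ⟨ω, hω⟩ := nonempty_of_measure_ne_zero hGoodne
    exact ⟨X ω, hsub ω hω⟩
  rcases eq_or_ne s 0 with rfl | hs0
  · simp
  have hs0 : 0 < s := pos_iff_ne_zero.2 hs0
  have hsS : (s : ℝ) * (L * Real.log d) < Real.log S := by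
    have h1 : (s : ℝ) < Real.log S / (L * Real.log d) := by
      have := (ENNReal.lt_ofReal_iff_toReal_lt ENNReal.coe_ne_top).1 hs
      simpa using this
    rwa [lt_div_iff₀ (by positivity)] at h1
  set b : ℝ := (d : ℝ) ^ L with hb
  have hb1 : 1 < b := one_lt_pow₀ hd1 (by omega)
  -- A j-cylinder has P-mass S^{-j} ∏ a^q, and the second factor is subexponential on `Good`. Fixing
  -- J makes the bound uniform, and some `G J` keeps positive mass.
  set G : ℕ → Set (ℕ → Fin (R + 1)) := fun J => {ω | ω ∈ Good ∧ ∀ j ≥ J,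
    ∏ i ∈ Finset.range j, P.weight (ω i) ≤ (b⁻¹ ^ j) ^ (s : ℝ)} with hG
  have hGun : Good ⊆ ⋃ J, G J := by
    intro ω hω
    have h1 : Tendsto (fun j : ℕ => q * ((∑ i ∈ Finset.range j, Real.log (a (ω i))) / j))
        atTop (𝓝 (q * 0)) := hω.const_mul q
    rw [mul_zero] at h1
    have h2 := h1.eventually (gt_mem_nhds (sub_pos.2 hsS))
    obtain ⟨J, hJ⟩ := eventually_atTop.1 (h2.and (eventually_gt_atTop 0))
    refine Set.mem_iUnion.2 ⟨J, hω, fun j hj => ?_⟩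
    obtain ⟨h3, h4⟩ := hJ j hj
    have hj0 : (0 : ℝ) < j := by exact_mod_cast h4
    rw [← Real.log_le_log_iff (Finset.prod_pos fun i _ => P.pos _) (by positivity),
      Real.log_prod fun i _ => (P.pos _).ne', Real.log_rpow (by positivity), Real.log_pow,
      Real.log_inv, hb, Real.log_pow]
    have h5 : ∀ M, Real.log (P.weight M) = q * Real.log (a M) - Real.log S := by
      intro M
      simp only [P]
      rw [Real.log_div (Real.rpow_pos_of_pos (ha0 M) _).ne' hS0.ne', Real.log_rpow (ha0 M)]
    simp_rw [h5]
    rw [Finset.sum_sub_distrib, ← Finset.mul_sum, Finset.sum_const, Finset.card_range,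
      nsmul_eq_mul]
    rw [mul_div_assoc', div_lt_iff₀ hj0] at h3
    linarith
  obtain ⟨J, hJ⟩ : ∃ J, ν (G J) ≠ 0 := by
    by_contra! hcon
    exact hGoodne (measure_mono_null hGun (measure_iUnion_null hcon))
  refine (le_dimH_image_of_measure_le ν hXm hJ hb1 (gap_pos (d := d) (L := L) hd') hs0 J ?_).trans
    (dimH_mono ?_)
  · intro ω hω j hj
    have h1 : {ω' | |X ω' - X ω| ≤ gap d L * b⁻¹ ^ j} ⊆
        {ω' : ℕ → Fin (R + 1) | ∀ i : Fin j, ω' i = ω i} := by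
      intro ω' hω' i
      have h2 := eq_of_abs_expansion_sub_le hd' hdm (hbar' ω') (hbar' ω) (j := j) (by
        rw [pow_mul, ← hb]
        have h3 := mul_le_mul_of_nonneg_right hω' (show 0 ≤ b ^ j by positivity)
        rwa [mul_assoc, inv_pow, inv_mul_cancel₀ (by positivity), mul_one] at h3) i i.2
      simp only [hu] at h2
      exact Fin.ext (by omega)
    refine (measure_mono h1).trans ?_
    rw [bernoulliMeasure_cylinder P fun i : Fin j => ω i]
    refine ENNReal.ofReal_le_ofReal ?_
    have := hω.2 j hj
    rwa [Finset.prod_range] at this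
  · rintro _ ⟨ω, hω, rfl⟩
    exact hsub ω hω.1

end

/-! ### Critical exponents, straddling lengths and the limit. -/

section

section PowerSums

variable {ι : Type*} [Fintype ι] {a : ι → ℝ}

lemma hasDerivAt_sum_rpow (ha : ∀ i, 0 < a i) (q : ℝ) :
    HasDerivAt (fun q : ℝ => ∑ i, a i ^ q) (∑ i, a i ^ q * Real.log (a i)) q := by
  refine HasDerivAt.fun_sum fun i _ => ?_
  have := (hasDerivAt_id q).const_rpow (ha i)
  simpa [mul_comm] using this

/-- The term with base above 1 forces growth at +∞, the term with base below 1 at -∞. -/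
lemma tendsto_sum_rpow_cocompact (ha : ∀ i, 0 < a i) {i j : ι} (hi : 1 < a i) (hj : a j < 1) :
    Tendsto (fun q : ℝ => ∑ i, a i ^ q) (cocompact ℝ) atTop := by
  have hle : ∀ (i : ι) (q : ℝ), a i ^ q ≤ ∑ i, a i ^ q := fun i q =>
    Finset.single_le_sum (f := fun i => a i ^ q)
      (fun i _ => (Real.rpow_pos_of_pos (ha i) q).le) (Finset.mem_univ i)
  rw [cocompact_eq_atBot_atTop, tendsto_sup]
  exact ⟨tendsto_atTop_mono (hle j) (tendsto_rpow_atBot_of_base_lt_one _ (ha j) hj),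
    tendsto_atTop_mono (hle i) (tendsto_rpow_atTop_of_base_gt_one _ hi)⟩

lemma one_le_sum_rpow (ha : ∀ i, 0 < a i) {i j : ι} (hi : 1 < a i) (hj : a j < 1) (q : ℝ) :
    1 ≤ ∑ i, a i ^ q := by
  have hle : ∀ i, a i ^ q ≤ ∑ i, a i ^ q := fun i =>
    Finset.single_le_sum (f := fun i => a i ^ q)
      (fun i _ => (Real.rpow_pos_of_pos (ha i) q).le) (Finset.mem_univ i)
  rcases le_total 0 q with hq | hq
  · exact (Real.one_le_rpow hi.le hq).trans (hle i)
  · exact (Real.one_le_rpow_of_pos_of_le_one_of_nonpos (ha j) hj.le hq).trans (hle j)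

end PowerSums

variable {d m : ℕ} (p : ProbVector m)

/-- A property stable under `v`-prefixed concatenation passes to repetitions. -/
lemma of_concat {n : ℕ} {Q : ℕ → Prop} (hQ : ∀ k l, Q k → Q l → Q (k + n + l)) {k : ℕ} (hk : Q k)
    (i : ℕ) : Q (n * i + k * (i + 1)) := by
  induction i with
  | zero => simpa using hk
  | succ i ih =>
    have := hQ _ _ ih hk
    rwa [show n * i + k * (i + 1) + n + k = n * (i + 1) + k * (i + 1 + 1) by ring] at this

/-- The exponents of the prefixed values of length `n + k` lie on both sides of `α`. -/
def Straddles (d : ℕ) {m : ℕ} (p : ProbVector m) (n : ℕ) (v : ℤ) (α : ℝ) (k : ℕ) : Prop :=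
  (∃ M ≤ maxVal d m k,
    ((d : ℝ) ^ (-α)) ^ (n + k) < valWeight d p (n + k) (v * (d : ℤ) ^ k + M)) ∧
  ∃ M ≤ maxVal d m k,
    valWeight d p (n + k) (v * (d : ℤ) ^ k + M) < ((d : ℝ) ^ (-α)) ^ (n + k)

section

variable {n : ℕ} {v : ℤ} {α : ℝ}

lemma exists_valWeight_gt_concat (hd : 1 < d) (hdm : d ≤ m) (hv : IsBarrierVal d m n v) (k l : ℕ)
    (hk : ∃ M ≤ maxVal d m k,
      ((d : ℝ) ^ (-α)) ^ (n + k) < valWeight d p (n + k) (v * (d : ℤ) ^ k + M))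
    (hl : ∃ M ≤ maxVal d m l,
      ((d : ℝ) ^ (-α)) ^ (n + l) < valWeight d p (n + l) (v * (d : ℤ) ^ l + M)) :
    ∃ M ≤ maxVal d m (k + n + l), ((d : ℝ) ^ (-α)) ^ (n + (k + n + l)) <
      valWeight d p (n + (k + n + l)) (v * (d : ℤ) ^ (k + n + l) + M) := by
  obtain ⟨M, hM, h1⟩ := hk
  obtain ⟨M', hM', h2⟩ := hl
  obtain ⟨K, hK, -, h3⟩ := exists_concat p hd hdm hv hM hM'
  refine ⟨K, hK, ?_⟩
  rw [h3, show n + (k + n + l) = (n + k) + (n + l) by ring, pow_add]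
  exact mul_lt_mul'' h1 h2 (by positivity) (by positivity)

lemma exists_valWeight_lt_concat (hd : 1 < d) (hdm : d ≤ m) (hv : IsBarrierVal d m n v) (k l : ℕ)
    (hk : ∃ M ≤ maxVal d m k,
      valWeight d p (n + k) (v * (d : ℤ) ^ k + M) < ((d : ℝ) ^ (-α)) ^ (n + k))
    (hl : ∃ M ≤ maxVal d m l,
      valWeight d p (n + l) (v * (d : ℤ) ^ l + M) < ((d : ℝ) ^ (-α)) ^ (n + l)) :
    ∃ M ≤ maxVal d m (k + n + l), valWeight d p (n + (k + n + l))
      (v * (d : ℤ) ^ (k + n + l) + M) < ((d : ℝ) ^ (-α)) ^ (n + (k + n + l)) := by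
  obtain ⟨M, hM, h1⟩ := hk
  obtain ⟨M', hM', h2⟩ := hl
  obtain ⟨K, hK, -, h3⟩ := exists_concat p hd hdm hv hM hM'
  refine ⟨K, hK, ?_⟩
  rw [h3, show n + (k + n + l) = (n + k) + (n + l) by ring, pow_add]
  exact mul_lt_mul'' h1 h2 (valWeight_nonneg p _ _) (valWeight_nonneg p _ _)

lemma Straddles.concat (hd : 1 < d) (hdm : d ≤ m) (hv : IsBarrierVal d m n v) {k l : ℕ}
    (hk : Straddles d p n v α k) (hl : Straddles d p n v α l) :
    Straddles d p n v α (k + n + l) :=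
  ⟨exists_valWeight_gt_concat p hd hdm hv k l hk.1 hl.1,
    exists_valWeight_lt_concat p hd hdm hv k l hk.2 hl.2⟩

/-- The large and the small weight may occur at different lengths n + k and n + l. Repeating the
first n + l times and the second n + k times gives both the total length (n + k)(n + l). -/
lemma exists_straddles (hd : 3 ≤ d) (hdm : d ≤ m) (hm : m + 2 < 2 * d) (hn : 0 < n)
    (hv : IsBarrierVal d m n v) (hα : α ∈ Set.Ioo (alphaLow d p) (alphaStar d p)) :
    ∃ k, Straddles d p n v α k := by
  obtain ⟨k, M, hM, h1⟩ := exists_valWeight_gt p hd hdm hm hv hα.1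
  obtain ⟨l, M', hM', h2⟩ := exists_valWeight_lt p n v hd hdm hm hα.2
  have g1 := of_concat (exists_valWeight_gt_concat (α := α) p (by omega) hdm hv)
    ⟨M, hM, h1⟩ (n + l - 1)
  have g2 := of_concat (exists_valWeight_lt_concat (α := α) p (by omega) hdm hv)
    ⟨M', hM', h2⟩ (n + k - 1)
  have e : n * (n + l - 1) + k * (n + l - 1 + 1) = n * (n + k - 1) + l * (n + k - 1 + 1) := by
    obtain ⟨n', rfl⟩ : ∃ n', n = n' + 1 := ⟨n - 1, by omega⟩
    rw [show n' + 1 + l - 1 = n' + l by omega, show n' + 1 + k - 1 = n' + k by omega]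
    ring
  rw [← e] at g2
  exact ⟨_, g1, g2⟩

/-- The normalised weight of a prefixed value. -/
def scaledWeight (d : ℕ) {m : ℕ} (p : ProbVector m) (n : ℕ) (v : ℤ) (α : ℝ) (k : ℕ)
    (M : Fin (maxVal d m k + 1)) : ℝ :=
  valWeight d p (n + k) (v * (d : ℤ) ^ k + (M : ℕ)) * (d : ℝ) ^ (α * (n + k : ℕ))

lemma scaledWeight_pos (hd : 1 < d) (hdm : d ≤ m) (hv : IsBarrierVal d m n v) (k : ℕ)
    (M : Fin (maxVal d m k + 1)) : 0 < scaledWeight d p n v α k M := by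
  have hb := hv.append hd (M := ((M : ℕ) : ℤ)) (k := k) (by omega)
    (by exact_mod_cast Nat.lt_succ_iff.1 M.2)
  have hd0 : (0 : ℝ) < d := by positivity
  exact mul_pos (valWeight_pos p (by omega) hdm (hb.nonneg hd hdm).le (hb.le_maxVal hd hdm))
    (by positivity)

lemma Straddles.exists_scaledWeight (hd : 1 < d) {k : ℕ} (hk : Straddles d p n v α k) :
    (∃ M, 1 < scaledWeight d p n v α k M) ∧ ∃ M, scaledWeight d p n v α k M < 1 := by
  have hd0 : (0 : ℝ) < d := by positivity
  have e : (d : ℝ) ^ (α * (n + k : ℕ)) * ((d : ℝ) ^ (-α)) ^ (n + k) = 1 := by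
    rw [← Real.rpow_natCast ((d : ℝ) ^ (-α)), ← Real.rpow_mul hd0.le, ← Real.rpow_add hd0,
      neg_mul, add_neg_cancel, Real.rpow_zero]
  have hp : 0 < (d : ℝ) ^ (α * (n + k : ℕ)) := by positivity
  obtain ⟨⟨M, hM, h1⟩, ⟨M', hM', h2⟩⟩ := hk
  refine ⟨⟨⟨M, by omega⟩, ?_⟩, ⟨⟨M', by omega⟩, ?_⟩⟩
  · have := mul_lt_mul_of_pos_left h1 hp
    rw [e] at this
    rw [scaledWeight, mul_comm]
    exact this
  · have := mul_lt_mul_of_pos_left h2 hp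
    rw [e] at this
    rw [scaledWeight, mul_comm]
    exact this

lemma log_scaledSum (hd : 1 < d) (hdm : d ≤ m) (hn : 0 < n) (hv : IsBarrierVal d m n v) (k : ℕ)
    (q : ℝ) : Real.log (scaledSum d p n v α k q) / ((n + k : ℕ) * Real.log d) =
      q * α - delta d * ((n + k : ℕ) : ℝ)⁻¹ * Real.log (prefixSum d p n v k q) := by
  have hd0 : (0 : ℝ) < d := by positivity
  have hlog : 0 < Real.log d := Real.log_pos (by exact_mod_cast hd)
  have hN : (0 : ℝ) < ((n + k : ℕ) : ℝ) := by positivity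
  rw [scaledSum_eq p (by omega), Real.log_mul (prefixSum_pos p hd hdm hv k q).ne' (by positivity),
    Real.log_rpow hd0, delta]
  field_simp
  ring

end

/-- The multifractal formalism, without assuming regularity of the weights. -/
theorem exists_limit_and_hausdorffSpectrum_eq (hd : 3 ≤ d) (hdm : d ≤ m) (hm : m + 2 < 2 * d) (n : ℕ) (w : Fin n → Fin (m + 1)) (hw : IsBarrier d w)
    (Ξ : (k : ℕ) → Finset (Fin k → Fin (m + 1)))
    (hΞ : ∀ k, IsTransversal d (Ξ k)) :
    ∃ τ : ℝ → ℝ,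
      (∀ q : ℝ, Tendsto
        (fun k : ℕ => delta d * ((n + k : ℕ) : ℝ)⁻¹ *
          Real.log (hatS d p w (Ξ k) q)) atTop (𝓝 (τ q))) ∧
      ∀ α ∈ Set.Ioo (alphaLow d p) (alphaStar d p),
        hausdorffSpectrum (selfSimilarMeasure d p) α =
          legendre τ α := by
  have hd' : 1 < d := by omega
  have hlog : 0 < Real.log d := Real.log_pos (by exact_mod_cast hd')
  have hv := hw.isBarrierVal hd'
  have hn := hv.length_pos hdm (by positivity) hd'
  obtain ⟨τ, hτ⟩ := exists_tau p hd' hdm hn hv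
  refine ⟨τ, fun q => ?_, fun α hα => ?_⟩
  · simp_rw [hatS_eq p (by omega : 0 < d) hdm w (Ξ _) (hΞ _)]
    exact (hτ q).1
  set E := levelSet (selfSimilarMeasure d p) α with hE
  have hpos : ∀ k M, 0 < scaledWeight d p n (val d w) α k M := scaledWeight_pos p hd' hdm hv
  have hlower : ∀ k, Straddles d p n (val d w) α k → ∃ q, E.Nonempty ∧
      ENNReal.ofReal (q * α - delta d * ((n + k : ℕ) : ℝ)⁻¹ *
        Real.log (prefixSum d p n (val d w) k q)) ≤ dimH E := by
    intro k hk
    obtain ⟨⟨M, hM⟩, M', hM'⟩ := hk.exists_scaledWeight p hd'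
    obtain ⟨q, hq⟩ := (continuous_iff_continuousAt.2 fun q =>
      (hasDerivAt_sum_rpow (hpos k) q).continuousAt).exists_forall_le
      (tendsto_sum_rpow_cocompact (hpos k) hM hM')
    have hcrit := IsLocalMin.hasDerivAt_eq_zero (Eventually.of_forall hq)
      (hasDerivAt_sum_rpow (hpos k) q)
    have := le_dimH_levelSet (α := α) (q := q) (k := k) p hd hdm hm hn hv hcrit
    rw [log_scaledSum p hd' hdm hn hv] at this
    exact ⟨q, this⟩
  obtain ⟨k₀, hk₀⟩ := exists_straddles p hd hdm hm hn hv hα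
  have hne : E ≠ ∅ := by
    obtain ⟨q, h, -⟩ := hlower k₀ hk₀
    exact h.ne_empty
  -- Needed so that the truncation in `ENNReal.ofReal` does not weaken the upper bound.
  have hnonneg : ∀ q, 0 ≤ q * α - τ q := by
    intro q
    obtain ⟨⟨M, hM⟩, M', hM'⟩ := hk₀.exists_scaledWeight p hd'
    have h1 : 1 ≤ scaledSum d p n (val d w) α k₀ q := one_le_sum_rpow (hpos k₀) hM hM' q
    have h2 : 0 ≤ Real.log (scaledSum d p n (val d w) α k₀ q) / ((n + k₀ : ℕ) * Real.log d) :=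
      div_nonneg (Real.log_nonneg h1) (by positivity)
    rw [log_scaledSum p hd' hdm hn hv] at h2
    linarith [(hτ q).2 k₀]
  rw [hausdorffSpectrum, if_neg hne]
  refine le_antisymm (le_iInf fun q => ?_) ?_
  · have h := EReal.coe_ennreal_le_coe_ennreal_iff.2
      (dimH_levelSet_le (α := α) p hd hdm hm hn hv (hτ q).1)
    rwa [EReal.coe_ennreal_ofReal, max_eq_left (hnonneg q)] at h
  by_contra! hlt
  obtain ⟨c, hc1, hc2⟩ := EReal.lt_iff_exists_real_btwn.1 hlt
  -- Total lengths double: n + κ (i + 1) = 2 (n + κ i). Supermultiplicativity then makes f i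
  -- increase with i, so the sublevel sets are nested.
  set κ : ℕ → ℕ := fun i => Nat.rec k₀ (fun _ k => k + n + k) i with hκ
  have hκsucc : ∀ i, κ (i + 1) = κ i + n + κ i := fun i => rfl
  have hκS : ∀ i, Straddles d p n (val d w) α (κ i) := by
    intro i
    induction i with
    | zero => exact hk₀
    | succ i ih => exact ih.concat p hd' hdm hv ih
  have hκtop : Tendsto κ atTop atTop := by
    refine (strictMono_nat_of_lt_succ fun i => ?_).tendsto_atTop
    rw [hκsucc]; omega
  set f : ℕ → ℝ → ℝ := fun i q => q * α - delta d * ((n + κ i : ℕ) : ℝ)⁻¹ *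
    Real.log (prefixSum d p n (val d w) (κ i) q) with hf
  have hfeq : ∀ i q, f i q = Real.log (∑ M, scaledWeight d p n (val d w) α (κ i) M ^ q) /
      ((n + κ i : ℕ) * Real.log d) := fun i q => (log_scaledSum p hd' hdm hn hv _ _).symm
  have hSpos : ∀ (i : ℕ) (q : ℝ), 0 < ∑ M, scaledWeight d p n (val d w) α (κ i) M ^ q := fun i q =>
    Finset.sum_pos (fun M _ => Real.rpow_pos_of_pos (hpos _ M) _) Finset.univ_nonempty
  have hScont : ∀ i, Continuous fun q : ℝ => ∑ M, scaledWeight d p n (val d w) α (κ i) M ^ q :=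
    fun i => continuous_iff_continuousAt.2 fun q =>
      (hasDerivAt_sum_rpow (hpos _) q).continuousAt
  have hclosed : ∀ i, IsClosed {q | f i q ≤ c} := by
    intro i
    simp_rw [hfeq]
    exact isClosed_le (((hScont i).log fun q => (hSpos i q).ne').div_const _) continuous_const
  have hcompact : IsCompact {q | f 0 q ≤ c} := by
    obtain ⟨⟨M, hM⟩, M', hM'⟩ := (hκS 0).exists_scaledWeight p hd'
    have hN : (0 : ℝ) < ((n + κ 0 : ℕ) : ℝ) * Real.log d := by positivity
    have h1 := (tendsto_sum_rpow_cocompact (hpos (κ 0)) hM hM').eventually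
      (eventually_gt_atTop (Real.exp (c * ((n + κ 0 : ℕ) * Real.log d))))
    obtain ⟨K, hK, hKsub⟩ := mem_cocompact.1 h1
    refine hK.of_isClosed_subset (hclosed 0) fun q hq => ?_
    by_contra hqK
    have h2 := hKsub hqK
    simp only [Set.mem_ofPred_eq] at h2 hq
    rw [hfeq, div_le_iff₀ hN, Real.log_le_iff_le_exp (hSpos 0 q)] at hq
    linarith
  have hanti : ∀ i, {q | f (i + 1) q ≤ c} ⊆ {q | f i q ≤ c} := by
    intro i q hq
    have hq' : f (i + 1) q ≤ c := hq
    refine le_trans (b := f (i + 1) q) ?_ hq'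
    have hP := prefixSum_pos p hd' hdm hv (κ i) q
    have h1 := Real.log_le_log (mul_pos hP hP) (prefixSum_mul_le p hd' hdm hv (κ i) (κ i) q)
    rw [Real.log_mul hP.ne' hP.ne', ← hκsucc] at h1
    have hN : (0 : ℝ) < ((n + κ i : ℕ) : ℝ) := by positivity
    have hN2 : ((n + κ (i + 1) : ℕ) : ℝ) = 2 * ((n + κ i : ℕ) : ℝ) := by
      rw [hκsucc]; push_cast; ring
    simp only [hf]
    rw [hN2, delta]
    have e : -1 / Real.log d * (2 * ((n + κ i : ℕ) : ℝ))⁻¹ *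
        Real.log (prefixSum d p n (val d w) (κ (i + 1)) q) ≤
        -1 / Real.log d * (2 * ((n + κ i : ℕ) : ℝ))⁻¹ *
        (Real.log (prefixSum d p n (val d w) (κ i) q) +
          Real.log (prefixSum d p n (val d w) (κ i) q)) :=
      mul_le_mul_of_nonpos_left h1 (mul_nonpos_of_nonpos_of_nonneg
        (div_nonpos_of_nonpos_of_nonneg (by norm_num) hlog.le) (by positivity))
    have e2 : -1 / Real.log d * (2 * ((n + κ i : ℕ) : ℝ))⁻¹ *
        (Real.log (prefixSum d p n (val d w) (κ i) q) +
          Real.log (prefixSum d p n (val d w) (κ i) q)) =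
        -1 / Real.log d * ((n + κ i : ℕ) : ℝ)⁻¹ *
          Real.log (prefixSum d p n (val d w) (κ i) q) := by
      field_simp
      ring
    linarith
  have hnonempty : ∀ i, {q | f i q ≤ c}.Nonempty := by
    intro i
    obtain ⟨q, -, hq⟩ := hlower (κ i) (hκS i)
    refine ⟨q, ?_⟩
    have h1 := (EReal.coe_ennreal_le_coe_ennreal_iff.2 hq).trans_lt hc1
    rw [EReal.coe_ennreal_ofReal] at h1
    exact ((le_max_left _ _).trans_lt (EReal.coe_lt_coe_iff.1 h1)).le
  -- If the dimension were below c, each sublevel set at c would contain the minimiser of f i. A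
  -- common point q then gives qα - τ q ≤ c, contrary to c being below the Legendre transform.
  obtain ⟨q, hq⟩ := IsCompact.nonempty_iInter_of_sequence_nonempty_isCompact_isClosed
    (fun i => {q | f i q ≤ c}) hanti hnonempty hcompact hclosed
  have hlim : Tendsto (fun i => f i q) atTop (𝓝 (q * α - τ q)) :=
    tendsto_const_nhds.sub ((hτ q).1.comp hκtop)
  have hle : q * α - τ q ≤ c := le_of_tendsto hlim
    (Eventually.of_forall fun i => Set.mem_iInter.1 hq i)
  have h1 : legendre τ α ≤ ((q * α - τ q : ℝ) : EReal) := iInf_le _ q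
  exact absurd (hc2.trans_le (h1.trans (EReal.coe_le_coe_iff.2 hle))) (lt_irrefl _)

end

end OverlapIFS

end

theorem theorem4 (d m : ℕ) (hd : 3 ≤ d) (hdm : d ≤ m) (hm : m + 2 < 2 * d)
    (p : OverlapIFS.ProbVector m) (hp : p.Regular)
    (n : ℕ) (w : Fin n → Fin (m + 1)) (hw : OverlapIFS.IsBarrier d w)
    (Ξ : (k : ℕ) → Finset (Fin k → Fin (m + 1)))
    (hΞ : ∀ k, OverlapIFS.IsTransversal d (Ξ k)) :
    ∃ τ : ℝ → ℝ,
      (∀ q : ℝ, Tendsto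
        (fun k : ℕ => OverlapIFS.delta d * ((n + k : ℕ) : ℝ)⁻¹ *
          Real.log (OverlapIFS.hatS d p w (Ξ k) q)) atTop (𝓝 (τ q))) ∧
      ∀ α ∈ Set.Ioo (OverlapIFS.alphaLow d p) (OverlapIFS.alphaStar d p),
        OverlapIFS.hausdorffSpectrum (OverlapIFS.selfSimilarMeasure d p) α =
          OverlapIFS.legendre τ α :=
  OverlapIFS.exists_limit_and_hausdorffSpectrum_eq p hd hdm hm n w hw Ξ hΞ
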